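/- Let $d\ge 1$ and let $\sigma, C_{\mathfrak I}, C'_{\mathfrak I}$ be real numbers. There is a constant $C>0$, depending only on $d,\sigma,C_{\mathfrak I},C'_{\mathfrak I}$, such that the following holds. Let $\Omega\subset\mathbb R^d$ be a bounded Lipschitz domain, and let $\mathcal T_H$ and $\mathcal T_h$ be regular (conforming, finite) simplicial triangulations of $\Omega$, where $\mathcal T_h$ is a refinement of $\mathcal T_H$ and both are shape regular with parameter $\sigma$ (every element $T$ contains a ball of diameter $\varrho>0$ with $\operatorname{diam}(T)\le\sigma\varrho$). Let $H$ be the mesh size function of $\mathcal T_H$, i.e. $H|_T=H_T:=\operatorname{diam}(T)$ for $T\in\mathcal T_H$, and let $V_H\subset V_h$ be the spaces of functions in $C^0(\overline\Omega)\cap H^1_0(\Omega)$ that are affine on every element of $\mathcal T_H$, respectively of $\mathcal T_h$. Write $|v|_{H^1(\Omega)}=\|\nabla v\|_{L^2(\Omega)}$ and $\langle\cdot,\cdot\rangle$ for the $L^2(\Omega)$ inner product, and let $C_p\ge 0$ be a constant with $\|v\|_{L^2(\Omega)}\le C_p|v|_{H^1(\Omega)}$ for all $v\in H^1_0(\Omega)$.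 Assume: (A1) $A\in L^\infty(\Omega,\mathbb R^{d\times d}_{\mathrm{sym}})$, with $\beta:=\operatorname{ess\,sup}_{x\in\Omega}\sup_{\zeta\ne0}\frac{A(x)\zeta\cdot\zeta}{|\zeta|^2}<\infty$ and $\alpha:=\operatorname{ess\,inf}_{x\in\Omega}\inf_{\zeta\ne0}\frac{A(x)\zeta\cdot\zeta}{|\zeta|^2}>0$. (A2) $F:\Omega\times\mathbb R\times\mathbb R^d\to\mathbb R$ is measurable, and there are $L_1,L_2>0$ such that for almost every $x\in\Omega$: $|F(x,\xi_1,\zeta)-F(x,\xi_2,\zeta)|\le L_1|\xi_1-\xi_2|$, $|F(x,\xi,\zeta_1)-F(x,\xi,\zeta_2)|\le L_2|\zeta_1-\zeta_2|$ for all arguments, and $F(x,0,0)=0$. (A3) With $\langle B(v),w\rangle:=\langle A\nabla v,\nabla w\rangle+\langle F(\cdot,v,\nabla v),w\rangle$, there is $c_0>0$ with $\langle B(u)-B(v),u-v\rangle\ge c_0|u-v|^2_{H^1(\Omega)}$ for all $u,v\in H^1_0(\Omega)$. (A4) $\mathfrak I_H:V_h\to V_H$ is linear. (A5) The restriction of $\mathfrak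 I_H$ to $V_H$ is an isomorphism of $V_H$. (A6) For all $v_h\in V_h$ and $T\in\mathcal T_H$, $H_T^{-1}\|v_h-\mathfrak I_Hv_h\|_{L^2(T)}+\|\nabla(v_h-\mathfrak I_Hv_h)\|_{L^2(T)}\le C_{\mathfrak I}\|\nabla v_h\|_{L^2(\omega_T)}$, where $\omega_T:=\bigcup\{K\in\mathcal T_H : \overline K\cap\overline T\ne\emptyset\}$. (A7) For every $v_H\in V_H$ there is $v_h\in V_h$ with $\mathfrak I_H(v_h)=v_H$, $|v_h|_{H^1(\Omega)}\le C'_{\mathfrak I}|v_H|_{H^1(\Omega)}$ and $\operatorname{supp}v_h\subset\operatorname{supp}v_H$. Let $V^{f}_h:=\ker\mathfrak I_H\subset V_h$, let $P:V_h\to V^f_h$ be the orthogonal projection with respect to $\langle A\nabla\cdot,\nabla\cdot\rangle$, i.e. $\langle A\nabla P(v),\nabla w\rangle=\langle A\nabla v,\nabla w\rangle$ for all $w\in V^f_h$, and let $V^{ms}_{H,h}:=\{v_H-P(v_H): v_H\in V_H\}$ (which is the orthogonal complement of $V^f_h$ in $V_h$ with respect to this inner product). Let $g\in L^2(\Omega)$,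 and let $u_h\in V_h$ and $u^{ms}_{H,h}\in V^{ms}_{H,h}$ be the Galerkin solutions $$\langle B(u_h),v\rangle=\langle g,v\rangle\ \text{ for all } v\in V_h,\qquad \langle B(u^{ms}_{H,h}),v\rangle=\langle g,v\rangle\ \text{ for all } v\in V^{ms}_{H,h}.$$ Then $$|u_h-u^{ms}_{H,h}|_{H^1(\Omega)}\le C\,\tilde C_0\Big(\|Hg\|_{L^2(\Omega)}+\|H\|_{L^\infty(\Omega)}\,C_p\,\frac{L_1C_p+L_2}{c_0}\,\|g\|_{L^2(\Omega)}\Big),\qquad \tilde C_0:=\frac{\beta+\|H\|_{L^\infty(\Omega)}(L_1C_p+L_2)}{c_0\,\alpha}.$$ -/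

import Mathlib

open MeasureTheory
open scoped ContDiff

namespace LOD

noncomputable section

/-- `ℝ^d` with the Euclidean norm. -/
abbrev Eucl (d : ℕ) : Type := EuclideanSpace ℝ (Fin d)

/-- A Lipschitz domain: open, connected, non-empty, and near each boundary point the region on one
side of a Lipschitz graph. The graph coordinate is in the direction of the unit vector `e`; the
tangential coordinates of `y` are its component `y - ⟪e, y⟫ e` orthogonal to `e`. -/
structure IsLipschitzDomain {d : ℕ} (Ω : Set (Eucl d)) : Prop where
  isOpen : IsOpen Ω
  isConnected : IsConnected Ω
  lipschitz_boundary : ∀ x ∈ frontier Ω, ∃ e : Eucl d, ‖e‖ = 1 ∧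
    ∃ U : Set (Eucl d), IsOpen U ∧ x ∈ U ∧
      ∃ (K : NNReal) (φ : Eucl d → ℝ), LipschitzWith K φ ∧
        ∀ y ∈ U, (y ∈ Ω ↔ φ (y - inner ℝ e y • e) < inner ℝ e y)

/-- Pairs (function, gradient field) in `L²(Ω) × L²(Ω; ℝ^d)`. A function `v ∈ H¹₀(Ω)` is handled
as the pair `(v, ∇v)`. -/
abbrev Pairs {d : ℕ} (Ω : Set (Eucl d)) : Type :=
  Lp ℝ 2 (volume.restrict Ω) × Lp (Eucl d) 2 (volume.restrict Ω)

/-- The pairs `(φ, ∇φ)` with `φ ∈ C_c^∞(Ω)`. -/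
def testPairs {d : ℕ} (Ω : Set (Eucl d)) : Submodule ℝ (Pairs Ω) where
  carrier := {p | ∃ φ : Eucl d → ℝ, ContDiff ℝ ∞ φ ∧ HasCompactSupport φ ∧ tsupport φ ⊆ Ω ∧
    p.1 =ᵐ[volume.restrict Ω] φ ∧ p.2 =ᵐ[volume.restrict Ω] gradient φ}
  zero_mem' := by
    refine ⟨fun _ => 0, contDiff_const, HasCompactSupport.zero, ?_, ?_, ?_⟩
    · have h : tsupport (fun _ : Eucl d => (0 : ℝ)) = ∅ := by
        rw [tsupport_eq_empty_iff]; rfl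
      simp [h]
    · exact Lp.coeFn_zero ℝ 2 (volume.restrict Ω)
    · filter_upwards [Lp.coeFn_zero (Eucl d) 2 (volume.restrict Ω)] with x hx
      have h : gradient (fun _ : Eucl d => (0 : ℝ)) x = 0 :=
        (hasGradientAt_const x (0 : ℝ)).gradient
      rw [h]; exact hx
  add_mem' := by
    rintro p q ⟨φ, hφ, hφc, hφs, hp1, hp2⟩ ⟨ψ, hψ, hψc, hψs, hq1, hq2⟩
    refine ⟨fun x => φ x + ψ x, hφ.add hψ, hφc.add hψc,
      (tsupport_add φ ψ).trans (Set.union_subset hφs hψs), ?_, ?_⟩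
    · filter_upwards [Lp.coeFn_add p.1 q.1, hp1, hq1] with x hx h1 h2
      rw [Prod.fst_add, hx, Pi.add_apply, h1, h2]
    · filter_upwards [Lp.coeFn_add p.2 q.2, hp2, hq2] with x hx h1 h2
      have h : gradient (fun x => φ x + ψ x) x = gradient φ x + gradient ψ x := by
        have h1 := (hφ.differentiable (by simp)) x
        have h2 := (hψ.differentiable (by simp)) x
        simp only [gradient]
        rw [← map_add, ← fderiv_add h1 h2]
        rfl
      rw [Prod.snd_add, hx, Pi.add_apply, h1, h2, h]
  smul_mem' := by
    rintro c p ⟨φ, hφ, hφc, hφs, hp1, hp2⟩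
    refine ⟨fun x => c * φ x, contDiff_const.mul hφ, hφc.mul_left,
      (closure_mono (fun x hx => right_ne_zero_of_mul hx)).trans hφs, ?_, ?_⟩
    · filter_upwards [Lp.coeFn_smul c p.1, hp1] with x hx h1
      rw [Prod.smul_fst, hx, Pi.smul_apply, h1, smul_eq_mul]
    · filter_upwards [Lp.coeFn_smul c p.2, hp2] with x hx h1
      have h : gradient (fun x => c * φ x) x = c • gradient φ x := by
        have h1 := (hφ.differentiable (by simp)) x
        simp only [gradient]
        rw [fderiv_const_mul h1 c]
        simp
      rw [Prod.smul_snd, hx, Pi.smul_apply, h1, h]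

/-- `H¹₀(Ω)`: the closure of `C_c^∞(Ω)` in the `H¹`-norm, each element being given together with
its weak gradient. For `v` in `H¹₀(Ω)`, `v.1` is the function and `v.2` its weak gradient, so that
`‖v.1‖` is the `L²(Ω)`-norm and `‖v.2‖` the `H¹(Ω)`-seminorm of `v`. -/
def H10 {d : ℕ} (Ω : Set (Eucl d)) : Submodule ℝ (Pairs Ω) :=
  (testPairs Ω).topologicalClosure

/-- `Cp ≥ 0` is a constant for the Poincaré-Friedrichs inequality on `H¹₀(Ω)`. -/
def IsPoincareConstant {d : ℕ} (Ω : Set (Eucl d)) (Cp : ℝ) : Prop :=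
  0 ≤ Cp ∧ ∀ v ∈ H10 Ω, ‖v.1‖ ≤ Cp * ‖v.2‖

/-! ### Triangulations and finite element spaces -/

/-- The closed simplex with vertex set `t`. -/
def cell {d : ℕ} (t : Finset (Eucl d)) : Set (Eucl d) := convexHull ℝ (t : Set (Eucl d))

/-- A regular (conforming) triangulation of `Ω`: finitely many closed `d`-simplices that cover
`closure Ω`, any two of which meet in a common face (which may be empty). -/
structure Triangulation {d : ℕ} (Ω : Set (Eucl d)) where
  /-- the vertex sets of the elements -/
  elems : Finset (Finset (Eucl d))
  card_eq : ∀ t ∈ elems, t.card = d + 1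
  affineIndependent : ∀ t ∈ elems, AffineIndependent ℝ ((↑) : t → Eucl d)
  conforming : ∀ s ∈ elems, ∀ t ∈ elems,
    cell s ∩ cell t = convexHull ℝ ((s : Set (Eucl d)) ∩ (t : Set (Eucl d)))
  covers : ⋃ t ∈ elems, cell t = closure Ω

namespace Triangulation

variable {d : ℕ} {Ω : Set (Eucl d)}

/-- `𝒯h` is a refinement of `𝒯H`. -/
def IsRefinementOf (𝒯h 𝒯H : Triangulation Ω) : Prop :=
  ∀ k ∈ 𝒯h.elems, ∃ t ∈ 𝒯H.elems, cell k ⊆ cell t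

/-- Shape regularity with parameter `σ`: each element `T` contains a ball whose diameter `2 r`
satisfies `diam T / (2 r) ≤ σ`. -/
def IsShapeRegular (𝒯 : Triangulation Ω) (σ : ℝ) : Prop :=
  ∀ t ∈ 𝒯.elems, ∃ (x : Eucl d) (r : ℝ), 0 < r ∧ Metric.closedBall x r ⊆ cell t ∧
    Metric.diam (cell t) ≤ σ * (2 * r)

/-- The piecewise constant mesh size function, equal to `diam T` in the interior of each
element `T`. (It is `0` on the skeleton of the triangulation, which is a null set.) -/
def meshSize (𝒯 : Triangulation Ω) (x : Eucl d) : ℝ :=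
  ∑ t ∈ 𝒯.elems, (interior (cell t)).indicator (fun _ => Metric.diam (cell t)) x

/-- `‖H‖_{L^∞(Ω)}` for the mesh size function `H`. -/
def meshSizeSup (𝒯 : Triangulation Ω) : ℝ :=
  (eLpNorm 𝒯.meshSize ⊤ (volume.restrict Ω)).toReal

/-- `‖H g‖_{L²(Ω)}` for the mesh size function `H`. -/
def meshWeightedNorm (𝒯 : Triangulation Ω) (g : Lp ℝ 2 (volume.restrict Ω)) : ℝ :=
  (eLpNorm (fun x => 𝒯.meshSize x * g x) 2 (volume.restrict Ω)).toReal

/-- `ω_T`, the union of all elements that meet `T`. -/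
def patch (𝒯 : Triangulation Ω) (t : Finset (Eucl d)) : Set (Eucl d) :=
  ⋃ k ∈ {k | k ∈ 𝒯.elems ∧ (cell k ∩ cell t).Nonempty}, cell k

/-- The conforming `P1` finite element space: the functions in `C⁰(closure Ω) ∩ H¹₀(Ω)` that are
affine on each element. -/
def feSpace (𝒯 : Triangulation Ω) : Submodule ℝ (Pairs Ω) where
  carrier := {v | v ∈ H10 Ω ∧ ∃ f : Eucl d → ℝ, ContinuousOn f (closure Ω) ∧
    v.1 =ᵐ[volume.restrict Ω] f ∧
    ∀ t ∈ 𝒯.elems, ∃ ℓ : Eucl d →ᵃ[ℝ] ℝ, ∀ x ∈ cell t, f x = ℓ x}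
  zero_mem' := ⟨(H10 Ω).zero_mem, 0, continuousOn_const,
    Lp.coeFn_zero ℝ 2 (volume.restrict Ω), fun _ _ => ⟨0, fun _ _ => rfl⟩⟩
  add_mem' := by
    rintro v w ⟨hv, f, hfc, hf, hfa⟩ ⟨hw, k, hkc, hk, hka⟩
    refine ⟨(H10 Ω).add_mem hv hw, f + k, hfc.add hkc, ?_, fun t ht => ?_⟩
    · filter_upwards [Lp.coeFn_add v.1 w.1, hf, hk] with x hx h1 h2
      rw [Prod.fst_add, hx, Pi.add_apply, Pi.add_apply, h1, h2]
    · obtain ⟨l, hl⟩ := hfa t ht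
      obtain ⟨m, hm⟩ := hka t ht
      exact ⟨l + m, fun x hx => by simp [hl x hx, hm x hx]⟩
  smul_mem' := by
    rintro c v ⟨hv, f, hfc, hf, hfa⟩
    refine ⟨(H10 Ω).smul_mem c hv, c • f, hfc.const_smul c, ?_, fun t ht => ?_⟩
    · filter_upwards [Lp.coeFn_smul c v.1, hf] with x hx h1
      rw [Prod.smul_fst, hx, Pi.smul_apply, Pi.smul_apply, h1]
    · obtain ⟨l, hl⟩ := hfa t ht
      exact ⟨c • l, fun x hx => by simp [hl x hx]⟩

theorem feSpace_le_of_isRefinementOf {𝒯h 𝒯H : Triangulation Ω} (h : 𝒯h.IsRefinementOf 𝒯H) :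
    𝒯H.feSpace ≤ 𝒯h.feSpace := by
  rintro v ⟨hv, f, hfc, hf, hfa⟩
  refine ⟨hv, f, hfc, hf, fun k hk => ?_⟩
  obtain ⟨t, ht, hkt⟩ := h k hk
  obtain ⟨l, hl⟩ := hfa t ht
  exact ⟨l, fun x hx => hl x (hkt hx)⟩

end Triangulation

/-! ### The differential operator -/

variable {d : ℕ} {Ω : Set (Eucl d)}

/-- `⟨A∇v, ∇w⟩_{L²(Ω)}`. -/
def diffusionForm (A : Eucl d → Matrix (Fin d) (Fin d) ℝ) (v w : Pairs Ω) : ℝ :=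
  ∫ x in Ω, (A x).mulVec (v.2 x).ofLp ⬝ᵥ (w.2 x).ofLp

/-- `⟨B(v), w⟩ = ⟨A∇v, ∇w⟩ + ⟨F(·, v, ∇v), w⟩`. -/
def operatorB (A : Eucl d → Matrix (Fin d) (Fin d) ℝ) (F : Eucl d → ℝ → Eucl d → ℝ)
    (v w : Pairs Ω) : ℝ :=
  diffusionForm A v w + ∫ x in Ω, F x (v.1 x) (v.2 x) * w.1 x

/-- `A ∈ L^∞(Ω, ℝ^{d×d}_sym)`, with `β` the essential supremum over `Ω` of the largest and `α > 0`
the essential infimum over `Ω` of the smallest value of the Rayleigh quotient `Aζ·ζ / |ζ|²`. -/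
structure AssumptionA1 (Ω : Set (Eucl d)) (A : Eucl d → Matrix (Fin d) (Fin d) ℝ)
    (α β : ℝ) : Prop where
  measurable : ∀ i j, AEMeasurable (fun x => A x i j) (volume.restrict Ω)
  symmetric : ∀ᵐ x ∂volume.restrict Ω, (A x).IsSymm
  isLeast_beta : IsLeast {b : ℝ | ∀ᵐ x ∂volume.restrict Ω, ∀ ζ : Eucl d,
    (A x).mulVec ζ.ofLp ⬝ᵥ ζ.ofLp ≤ b * ‖ζ‖ ^ 2} β
  isGreatest_alpha : IsGreatest {a : ℝ | ∀ᵐ x ∂volume.restrict Ω, ∀ ζ : Eucl d,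
    a * ‖ζ‖ ^ 2 ≤ (A x).mulVec ζ.ofLp ⬝ᵥ ζ.ofLp} α
  alpha_pos : 0 < α

/-- `F` is measurable, Lipschitz continuous in its second argument with constant `L₁` and in its
third argument with constant `L₂`, and `F(x, 0, 0) = 0`, for almost every `x ∈ Ω`. (The values of
`F` outside `Ω` play no role; extend `F` by zero.) -/
structure AssumptionA2 (Ω : Set (Eucl d)) (F : Eucl d → ℝ → Eucl d → ℝ) (L₁ L₂ : ℝ) : Prop where
  measurable : Measurable fun p : Eucl d × ℝ × Eucl d => F p.1 p.2.1 p.2.2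
  L₁_pos : 0 < L₁
  L₂_pos : 0 < L₂
  lipschitz_fst : ∀ᵐ x ∂volume.restrict Ω, ∀ (ζ : Eucl d) (ξ₁ ξ₂ : ℝ),
    |F x ξ₁ ζ - F x ξ₂ ζ| ≤ L₁ * |ξ₁ - ξ₂|
  lipschitz_snd : ∀ᵐ x ∂volume.restrict Ω, ∀ (ζ₁ ζ₂ : Eucl d) (ξ : ℝ),
    |F x ξ ζ₁ - F x ξ ζ₂| ≤ L₂ * ‖ζ₁ - ζ₂‖
  map_zero : ∀ᵐ x ∂volume.restrict Ω, F x 0 0 = 0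

/-- `B` is strongly monotone on `H¹₀(Ω)` with constant `c₀ > 0`. -/
structure AssumptionA3 (Ω : Set (Eucl d)) (A : Eucl d → Matrix (Fin d) (Fin d) ℝ)
    (F : Eucl d → ℝ → Eucl d → ℝ) (c₀ : ℝ) : Prop where
  c₀_pos : 0 < c₀
  strongly_monotone : ∀ u ∈ H10 Ω, ∀ v ∈ H10 Ω,
    c₀ * ‖u.2 - v.2‖ ^ 2 ≤ operatorB A F u (u - v) - operatorB A F v (u - v)

/-! ### The interpolation operator and the multiscale space -/

/-- The `L²(S ∩ Ω)`-norm of (the restriction to `S` of) a function on `Ω`. -/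
def l2NormOn {G : Type*} [NormedAddCommGroup G] (S : Set (Eucl d))
    (f : Lp G 2 (volume.restrict Ω)) : ℝ :=
  (eLpNorm f 2 ((volume.restrict Ω).restrict S)).toReal

/-- The (essential) support of a function on `Ω`: the points none of whose neighbourhoods `U`
satisfies `f = 0` almost everywhere in `U ∩ Ω`. For `f` continuous on `closure Ω`, and `Ω` open,
it is the closure of `{x ∈ Ω | f x ≠ 0}`. -/
def essentialSupport (f : Lp ℝ 2 (volume.restrict Ω)) : Set (Eucl d) :=
  {x | ∀ U ∈ nhds x, ¬ (f =ᵐ[(volume.restrict Ω).restrict U] 0)}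

/-- The assumptions on the interpolation operator `I : V_h → V_H` (whose linearity is part of its
type), with the constants `CI` of the stability and approximation estimate and `CI'` of the
lifting property. -/
structure AssumptionsA4A7 {𝒯h 𝒯H : Triangulation Ω} (href : 𝒯h.IsRefinementOf 𝒯H)
    (I : 𝒯h.feSpace →ₗ[ℝ] 𝒯H.feSpace) (CI CI' : ℝ) : Prop where
  bijective_restriction : Function.Bijective
    (I ∘ₗ Submodule.inclusion (Triangulation.feSpace_le_of_isRefinementOf href))
  local_estimate : ∀ v : 𝒯h.feSpace, ∀ t ∈ 𝒯H.elems,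
    (Metric.diam (cell t))⁻¹ * l2NormOn (cell t) (v.1.1 - (I v).1.1)
      + l2NormOn (cell t) (v.1.2 - (I v).1.2) ≤ CI * l2NormOn (𝒯H.patch t) v.1.2
  lifting : ∀ w : 𝒯H.feSpace, ∃ v : 𝒯h.feSpace, I v = w ∧ ‖v.1.2‖ ≤ CI' * ‖w.1.2‖ ∧
    essentialSupport v.1.1 ⊆ essentialSupport w.1.1

/-- The fine scale space `V^f_h = ker I`. -/
def fineSpace {𝒯h 𝒯H : Triangulation Ω} (I : 𝒯h.feSpace →ₗ[ℝ] 𝒯H.feSpace) :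
    Submodule ℝ (Pairs Ω) :=
  (LinearMap.ker I).map 𝒯h.feSpace.subtype

/-- `p = P(v)` for the `⟨A∇·, ∇·⟩`-orthogonal projection `P` onto `V^f_h`. -/
def IsFineProjection {𝒯h 𝒯H : Triangulation Ω} (A : Eucl d → Matrix (Fin d) (Fin d) ℝ)
    (I : 𝒯h.feSpace →ₗ[ℝ] 𝒯H.feSpace) (v p : Pairs Ω) : Prop :=
  p ∈ fineSpace I ∧ ∀ w ∈ fineSpace I, diffusionForm A p w = diffusionForm A v w

/-- The multiscale space `V^ms_{H,h} = {v_H - P(v_H) | v_H ∈ V_H}`. -/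
def multiscaleSpace {𝒯h 𝒯H : Triangulation Ω} (A : Eucl d → Matrix (Fin d) (Fin d) ℝ)
    (I : 𝒯h.feSpace →ₗ[ℝ] 𝒯H.feSpace) : Set (Pairs Ω) :=
  {w | ∃ v ∈ 𝒯H.feSpace, ∃ p, IsFineProjection A I v p ∧ w = v - p}

/-- `u` is a Galerkin solution in `W`: `u ∈ W` and `⟨B(u), v⟩ = ⟨g, v⟩` for all `v ∈ W`. -/
def IsGalerkinSolution (A : Eucl d → Matrix (Fin d) (Fin d) ℝ) (F : Eucl d → ℝ → Eucl d → ℝ)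
    (g : Lp ℝ 2 (volume.restrict Ω)) (W : Set (Pairs Ω)) (u : Pairs Ω) : Prop :=
  u ∈ W ∧ ∀ v ∈ W, operatorB A F u v = ∫ x in Ω, g x * v.1 x

end

end LOD

/-! ### Geometry of shape regular triangulations -/

namespace LOD
namespace Triangulation

variable {d : ℕ} {Ω : Set (Eucl d)}

/-! Let `p = P(u_h)`, `e = u_h - u^ms` and `M = L₁ Cp + L₂`. Since `I` maps `V_H` onto itself, `u_h
- p` lies in `V^ms`, so `e = p + w` with `w = u_h - p - u^ms` in `V^ms`. Both solutions satisfy the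
equation tested with `w`, so strong monotonicity leaves `c₀|e|² ≤ ⟨B(u_h) - B(u^ms), p⟩ ≤ β|e||p| +
M|e|‖p‖`. The size of `p` comes from testing the equation for `u_h` with `p`: `α|p|² ≤ ⟨A∇p, ∇p⟩ =
⟨A∇u_h, ∇p⟩ = ⟨g, p⟩ - ⟨F(·, u_h, ∇u_h), p⟩`, where the a priori bound `c₀|u_h| ≤ Cp‖g‖` controls
the last term.

The mesh size enters because `I p = 0`: the local estimate bounds `p / H` on each element by the
gradient on its patch. Summed over elements (`AssumptionsA4A7.exists_eq_meshSize_mul`), this gives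
`p = H q` with `‖q‖ ≤ κ|p|`, hence both `‖p‖ ≤ κ‖H‖_∞|p|` and `⟨g, p⟩ ≤ κ‖Hg‖|p|`. The sum is
controlled by the finite overlap of patches (`sum_setIntegral_patch_le`), a volume argument around a
vertex.

The projection is described by a relation, so its value at `u_h` has to be produced
(`exists_isFineProjection`): `V_h` is finite-dimensional and the diffusion form is definite on it.
-/

theorem volume_cell_inter_cell (𝒯 : Triangulation Ω) {s t : Finset (Eucl d)}
    (hs : s ∈ 𝒯.elems) (ht : t ∈ 𝒯.elems) (hne : s ≠ t) :
    volume (cell s ∩ cell t) = 0 := by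
  classical
  have hcoe : ((s : Set (Eucl d)) ∩ (t : Set (Eucl d))) = ((s ∩ t : Finset (Eucl d)) : Set (Eucl d)) := by
    simp
  rw [𝒯.conforming s hs t ht, hcoe]
  refine measure_mono_null (convexHull_subset_affineSpan _) ?_
  -- If the common vertices spanned the whole space, there would be `d + 1` of them, forcing `s =
  -- t`.
  refine Measure.addHaar_affineSubspace _ _ fun htop => ?_
  have hind : AffineIndependent ℝ ((↑) : (s ∩ t : Finset (Eucl d)) → Eucl d) :=
    (𝒯.affineIndependent s hs).mono (t := (s : Set (Eucl d))) (s := ((s ∩ t : Finset (Eucl d)) : Set (Eucl d)))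
      (by simp)
  have hrange : Set.range ((↑) : (s ∩ t : Finset (Eucl d)) → Eucl d) =
      ((s ∩ t : Finset (Eucl d)) : Set (Eucl d)) := by ext; simp
  have hcard := (hind.affineSpan_eq_top_iff_card_eq_finrank_add_one).1 (by rw [hrange]; exact htop)
  rw [finrank_euclideanSpace_fin, Fintype.card_coe] at hcard
  have h1 : s ∩ t = s := Finset.eq_of_subset_of_card_le Finset.inter_subset_left
    (by rw [hcard, 𝒯.card_eq s hs])
  have h2 : s ∩ t = t := Finset.eq_of_subset_of_card_le Finset.inter_subset_right
    (by rw [hcard, 𝒯.card_eq t ht])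
  exact hne (h1.symm.trans h2)

theorem isCompact_cell (t : Finset (Eucl d)) : IsCompact (cell t) :=
  t.finite_toSet.isCompact_convexHull (𝕜 := ℝ)

theorem convex_cell (t : Finset (Eucl d)) : Convex ℝ (cell t) := convex_convexHull ℝ _

theorem measurableSet_cell (t : Finset (Eucl d)) : MeasurableSet (cell t) :=
  (isCompact_cell t).isClosed.measurableSet

theorem diam_cell_pos (𝒯 : Triangulation Ω) (hd : 0 < d) {t : Finset (Eucl d)}
    (ht : t ∈ 𝒯.elems) : 0 < Metric.diam (cell t) := by
  have h1 : 1 < t.card := by rw [𝒯.card_eq t ht]; omega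
  obtain ⟨a, ha, b, hb, hab⟩ := Finset.one_lt_card.1 h1
  exact (dist_pos.2 hab).trans_le (Metric.dist_le_diam_of_mem (isCompact_cell t).isBounded
    (subset_convexHull ℝ _ ha) (subset_convexHull ℝ _ hb))

/-- A convex set of diameter at most `2 σ r` containing `z` and a ball of radius `r` contains, at
distance at most `δ` from `z`, a ball of radius `δ / (2 σ)`. -/
theorem exists_closedBall_subset_of_convex {E : Type*} [NormedAddCommGroup E] [NormedSpace ℝ E]
    {S : Set E} (hS : Convex ℝ S) (hb : Bornology.IsBounded S) {z x : E} (hz : z ∈ S)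
    {r σ δ : ℝ} (hr : 0 < r) (hball : Metric.closedBall x r ⊆ S)
    (hσ : Metric.diam S ≤ σ * (2 * r)) (hδ : 0 < δ) (hδS : δ ≤ Metric.diam S) :
    ∃ c, Metric.closedBall c (δ / (2 * σ)) ⊆ S ∩ Metric.closedBall z δ := by
  set D := Metric.diam S
  have hD : 0 < D := hδ.trans_le hδS
  have hσ0 : 0 < σ := by
    by_contra h
    nlinarith
  -- The homothety with centre `z` and ratio `δ / D ≤ 1` maps `S` into itself and into the `δ`-ball
  -- about `z`. The ball sought is the image of the one about `x` of radius `D / (2σ) ≤ r`; `w` is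
  -- the preimage of `y`.
  refine ⟨z + (δ / D) • (x - z), fun y hy => ?_⟩
  set w := z + (D / δ) • (y - z) with hw
  have hyw : y = z + (δ / D) • (w - z) := by
    rw [hw, add_sub_cancel_left, smul_smul, div_mul_div_comm, mul_comm δ D,
      div_self (by positivity), one_smul, add_sub_cancel]
  have hwS : w ∈ S := by
    apply hball
    have h1 : w - x = (D / δ) • (y - (z + (δ / D) • (x - z))) := by
      have h2 : (D / δ) • (δ / D) • (x - z) = x - z := by
        rw [smul_smul, div_mul_div_comm, mul_comm δ D, div_self (by positivity), one_smul]
      rw [← sub_sub, smul_sub, h2, hw]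
      abel
    rw [Metric.mem_closedBall, dist_eq_norm] at hy ⊢
    rw [h1, norm_smul, Real.norm_of_nonneg (by positivity)]
    calc D / δ * ‖y - (z + (δ / D) • (x - z))‖ ≤ D / δ * (δ / (2 * σ)) := by gcongr
      _ = D / (2 * σ) := by field_simp
      _ ≤ r := by rw [div_le_iff₀ (by positivity)]; linarith
  constructor
  · rw [hyw]
    have h0 : 0 ≤ δ / D := by positivity
    have h1 : δ / D ≤ 1 := (div_le_one hD).2 hδS
    exact hS.add_smul_sub_mem hz hwS ⟨h0, h1⟩
  · rw [Metric.mem_closedBall, dist_eq_norm, hyw, add_sub_cancel_left, norm_smul,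
      Real.norm_of_nonneg (by positivity), ← dist_eq_norm]
    calc δ / D * dist w z ≤ δ / D * D := by
          gcongr
          exact Metric.dist_le_diam_of_mem hb hwS hz
      _ = δ := by field_simp

open Classical in
/-- The number of elements of a shape regular triangulation that contain a given vertex. -/
theorem card_filter_mem_le (𝒯 : Triangulation Ω) (hd : 0 < d) {σ : ℝ}
    (hσ : 𝒯.IsShapeRegular σ) (z : Eucl d) :
    ((𝒯.elems.filter (z ∈ ·)).card : ℝ) ≤ |2 * σ| ^ d := by
  set E := 𝒯.elems.filter (z ∈ ·) with hE
  rcases E.eq_empty_or_nonempty with h0 | hne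
  · rw [h0]; simp
  -- With `δ` the smallest diameter at `z`, every element at `z` contains a ball of the same radius
  -- `δ / (2σ)` inside the `δ`-ball about `z`. These balls overlap in null sets, so comparing
  -- volumes bounds their number.
  obtain ⟨t₀, ht₀, hmin⟩ := E.exists_min_image (fun t => Metric.diam (cell t)) hne
  set δ := Metric.diam (cell t₀)
  have hδ : 0 < δ := 𝒯.diam_cell_pos hd (Finset.mem_filter.1 ht₀).1
  have hσ0 : 0 < σ := by
    obtain ⟨x, r, hr, -, h⟩ := hσ t₀ (Finset.mem_filter.1 ht₀).1
    by_contra h'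
    have : 0 < Metric.diam (cell t₀) := hδ
    nlinarith
  have key : ∀ t ∈ E, ∃ c, Metric.closedBall c (δ / (2 * σ)) ⊆
      cell t ∩ Metric.closedBall z δ := by
    intro t ht
    obtain ⟨htE, hzt⟩ := Finset.mem_filter.1 ht
    obtain ⟨x, r, hr, hball, h⟩ := hσ t htE
    exact exists_closedBall_subset_of_convex (convex_cell t) (isCompact_cell t).isBounded
      (subset_convexHull ℝ _ hzt) hr hball h hδ (hmin t ht)
  choose! c hc using key
  have hle : ∑ t ∈ E, volume (Metric.closedBall (c t) (δ / (2 * σ))) ≤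
      volume (Metric.closedBall z δ) := by
    rw [← measure_biUnion_finset₀]
    · exact measure_mono (Set.iUnion₂_subset fun t ht => (hc t ht).trans Set.inter_subset_right)
    · intro s hs t ht hst
      refine measure_mono_null ?_ (𝒯.volume_cell_inter_cell (Finset.mem_filter.1 hs).1
        (Finset.mem_filter.1 ht).1 hst)
      exact Set.inter_subset_inter ((hc s hs).trans Set.inter_subset_left)
        ((hc t ht).trans Set.inter_subset_left)
    · exact fun t _ => Metric.isClosed_closedBall.measurableSet.nullMeasurableSet
  have hV0 : volume (Metric.ball (0 : Eucl d) 1) ≠ 0 :=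
    (Metric.measure_ball_pos _ _ one_pos).ne'
  have hV1 : volume (Metric.ball (0 : Eucl d) 1) ≠ ⊤ := measure_ball_lt_top.ne
  have hρ : 0 < δ / (2 * σ) := by positivity
  simp only [Measure.addHaar_closedBall _ _ hρ.le, Measure.addHaar_closedBall _ _ hδ.le,
    finrank_euclideanSpace_fin, Finset.sum_const, nsmul_eq_mul] at hle
  rw [← mul_assoc, ENNReal.mul_le_mul_iff_left hV0 hV1, ← ENNReal.ofReal_natCast,
    ← ENNReal.ofReal_mul (by positivity), ENNReal.ofReal_le_ofReal_iff (by positivity)] at hle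
  rw [abs_of_pos (by positivity)]
  have h3 : δ ^ d = (2 * σ) ^ d * (δ / (2 * σ)) ^ d := by
    rw [← mul_pow]; congr 1; field_simp
  rw [h3] at hle
  exact le_of_mul_le_mul_right hle (by positivity)

open Classical in
/-- The number of elements of a shape regular triangulation that meet a given element. -/
theorem card_filter_inter_nonempty_le (𝒯 : Triangulation Ω) (hd : 0 < d) {σ : ℝ}
    (hσ : 𝒯.IsShapeRegular σ) {k : Finset (Eucl d)} (hk : k ∈ 𝒯.elems) :
    ((𝒯.elems.filter fun t => (cell k ∩ cell t).Nonempty).card : ℝ) ≤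
      (d + 1) * |2 * σ| ^ d := by
  -- By conformity, elements that meet share a vertex, so it suffices to count around the `d + 1`
  -- vertices of `k`.
  have hsub : (𝒯.elems.filter fun t => (cell k ∩ cell t).Nonempty) ⊆
      k.biUnion fun z => 𝒯.elems.filter (z ∈ ·) := by
    intro t ht
    obtain ⟨htE, hne⟩ := Finset.mem_filter.1 ht
    rw [𝒯.conforming k hk t htE, convexHull_nonempty_iff] at hne
    obtain ⟨z, hzk, hzt⟩ := hne
    exact Finset.mem_biUnion.2 ⟨z, hzk, Finset.mem_filter.2 ⟨htE, hzt⟩⟩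
  calc ((𝒯.elems.filter fun t => (cell k ∩ cell t).Nonempty).card : ℝ)
      ≤ ((∑ z ∈ k, (𝒯.elems.filter (z ∈ ·)).card : ℕ) : ℝ) := by
        exact_mod_cast (Finset.card_le_card hsub).trans Finset.card_biUnion_le
    _ ≤ ∑ z ∈ k, |2 * σ| ^ d := by
        push_cast
        exact Finset.sum_le_sum fun z _ => 𝒯.card_filter_mem_le hd hσ z
    _ = (d + 1) * |2 * σ| ^ d := by
        rw [Finset.sum_const, 𝒯.card_eq k hk, nsmul_eq_mul]; push_cast; ring

end Triangulation
end LOD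

/-! ### Elementwise `L²` norms, the mesh size function and patch overlap -/

namespace LOD

theorem toReal_eLpNorm_two_sq {X G : Type*} [MeasurableSpace X] [NormedAddCommGroup G]
    {ν : Measure X} {f : X → G} (hf : MemLp f 2 ν) :
    (eLpNorm f 2 ν).toReal ^ 2 = ∫ x, ‖f x‖ ^ 2 ∂ν := by
  have h0 : 0 ≤ ∫ x, ‖f x‖ ^ 2 ∂ν := integral_nonneg fun x => by positivity
  rw [hf.eLpNorm_eq_integral_rpow_norm (by norm_num) (by norm_num)]
  simp only [ENNReal.toReal_ofNat, Real.rpow_ofNat]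
  rw [ENNReal.toReal_ofReal (Real.rpow_nonneg h0 _), ← Real.rpow_natCast, ← Real.rpow_mul h0]
  norm_num

theorem integral_mul_le_toReal_eLpNorm {X : Type*} [MeasurableSpace X]
    {ν : Measure X} {f g : X → ℝ} (hf : MemLp f 2 ν) (hg : MemLp g 2 ν) :
    ∫ x, f x * g x ∂ν ≤ (eLpNorm f 2 ν).toReal * (eLpNorm g 2 ν).toReal := by
  have h := real_inner_le_norm (hf.toLp f) (hg.toLp g)
  rw [L2.inner_def, Lp.norm_toLp, Lp.norm_toLp] at h
  refine le_trans (le_of_eq (integral_congr_ae ?_)) h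
  filter_upwards [hf.coeFn_toLp, hg.coeFn_toLp] with x h1 h2
  rw [h1, h2]; simp [mul_comm]

variable {d : ℕ} {Ω : Set (Eucl d)}

theorem l2NormOn_sq {G : Type*} [NormedAddCommGroup G] (S : Set (Eucl d))
    (f : Lp G 2 (volume.restrict Ω)) :
    l2NormOn S f ^ 2 = ∫ x in S, ‖f x‖ ^ 2 ∂(volume.restrict Ω) :=
  toReal_eLpNorm_two_sq ((Lp.memLp f).restrict S)

theorem l2NormOn_nonneg {G : Type*} [NormedAddCommGroup G] (S : Set (Eucl d))
    (f : Lp G 2 (volume.restrict Ω)) : 0 ≤ l2NormOn S f := ENNReal.toReal_nonneg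

namespace Triangulation

/-- The intersection of the interiors is open and null, hence empty. -/
theorem disjoint_interior_cell (𝒯 : Triangulation Ω) {s t : Finset (Eucl d)}
    (hs : s ∈ 𝒯.elems) (ht : t ∈ 𝒯.elems) (hne : s ≠ t) :
    Disjoint (interior (cell s)) (interior (cell t)) := by
  rw [Set.disjoint_iff_inter_eq_empty]
  refine (isOpen_interior.inter isOpen_interior).measure_eq_zero_iff volume |>.1 ?_
  exact measure_mono_null (Set.inter_subset_inter interior_subset interior_subset)
    (𝒯.volume_cell_inter_cell hs ht hne)

theorem interior_cell_ae_eq (t : Finset (Eucl d)) {ν : Measure (Eucl d)} (hν : ν ≪ volume) :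
    interior (cell t) =ᵐ[ν] cell t :=
  hν.ae_le (interior_ae_eq_of_null_frontier ((convex_cell t).addHaar_frontier volume))

theorem ae_mem_interior_cell (𝒯 : Triangulation Ω) :
    ∀ᵐ x ∂volume.restrict Ω, x ∈ ⋃ t ∈ 𝒯.elems, interior (cell t) := by
  have h1 : ∀ᵐ x ∂(volume : Measure (Eucl d)), ∀ t ∈ 𝒯.elems, x ∉ frontier (cell t) :=
    (Finset.eventually_all 𝒯.elems).2 fun t _ =>
      measure_eq_zero_iff_ae_notMem.1 ((convex_cell t).addHaar_frontier volume)
  have h2 : ∀ᵐ x ∂volume.restrict Ω, x ∈ closure Ω :=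
    ae_mono (Measure.restrict_mono subset_closure le_rfl)
      (ae_restrict_mem isClosed_closure.measurableSet)
  filter_upwards [ae_restrict_of_ae h1, h2] with x hx1 hx2
  rw [← 𝒯.covers] at hx2
  obtain ⟨t, ht, hxt⟩ := Set.mem_iUnion₂.1 hx2
  refine Set.mem_iUnion₂.2 ⟨t, ht, ?_⟩
  by_contra hni
  exact hx1 t ht ⟨subset_closure hxt, hni⟩

theorem meshSize_eq_diam (𝒯 : Triangulation Ω) {t : Finset (Eucl d)} (ht : t ∈ 𝒯.elems)
    {x : Eucl d} (hx : x ∈ interior (cell t)) : 𝒯.meshSize x = Metric.diam (cell t) := by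
  rw [meshSize, Finset.sum_eq_single_of_mem t ht, Set.indicator_of_mem hx]
  intro s hs hst
  exact Set.indicator_of_notMem (fun h => Set.disjoint_left.1
    (𝒯.disjoint_interior_cell hs ht hst) h hx) _

theorem measurable_meshSize (𝒯 : Triangulation Ω) : Measurable 𝒯.meshSize := by
  unfold meshSize
  exact Finset.measurable_sum _ fun t _ => measurable_const.indicator isOpen_interior.measurableSet

/-- Closed cells are disjoint only up to null sets, so the splitting is done on their interiors,
which differ from the cells by null frontiers. -/
theorem integral_eq_sum_cell (𝒯 : Triangulation Ω) {f : Eucl d → ℝ}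
    (hf : Integrable f (volume.restrict Ω)) :
    ∫ x, f x ∂volume.restrict Ω =
      ∑ t ∈ 𝒯.elems, ∫ x in cell t, f x ∂(volume.restrict Ω) := by
  conv_lhs => rw [← Measure.restrict_eq_self_of_ae_mem 𝒯.ae_mem_interior_cell]
  rw [integral_biUnion_finset _ (fun t _ => isOpen_interior.measurableSet)
    (fun s hs t ht hst => 𝒯.disjoint_interior_cell hs ht hst) (fun t _ => hf.integrableOn)]
  exact Finset.sum_congr rfl fun t _ =>
    setIntegral_congr_set (interior_cell_ae_eq t Measure.absolutelyContinuous_restrict)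

open Classical in
theorem setIntegral_patch_le (𝒯 : Triangulation Ω) {f : Eucl d → ℝ}
    (hf : Integrable f (volume.restrict Ω)) (h0 : ∀ x, 0 ≤ f x) (t : Finset (Eucl d)) :
    ∫ x in 𝒯.patch t, f x ∂(volume.restrict Ω) ≤
      ∑ k ∈ 𝒯.elems.filter (fun k => (cell k ∩ cell t).Nonempty),
        ∫ x in cell k, f x ∂(volume.restrict Ω) := by
  have hpatch : 𝒯.patch t =
      ⋃ k ∈ 𝒯.elems.filter (fun k => (cell k ∩ cell t).Nonempty), cell k := by
    ext x; simp [patch]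
  have hint : ∀ᵐ x ∂(volume.restrict Ω).restrict (𝒯.patch t),
      x ∈ ⋃ k ∈ 𝒯.elems.filter (fun k => (cell k ∩ cell t).Nonempty), interior (cell k) := by
    have hm : MeasurableSet (𝒯.patch t) := by
      rw [hpatch]; exact Finset.measurableSet_biUnion _ fun k _ => measurableSet_cell k
    have h1 : ∀ᵐ x ∂(volume : Measure (Eucl d)), ∀ k ∈ 𝒯.elems, x ∉ frontier (cell k) :=
      (Finset.eventually_all 𝒯.elems).2 fun t _ =>
        measure_eq_zero_iff_ae_notMem.1 ((convex_cell t).addHaar_frontier volume)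
    filter_upwards [ae_restrict_of_ae (ae_restrict_of_ae h1), ae_restrict_mem hm] with x hx1 hx2
    rw [hpatch] at hx2
    obtain ⟨k, hk, hxk⟩ := Set.mem_iUnion₂.1 hx2
    refine Set.mem_iUnion₂.2 ⟨k, hk, ?_⟩
    by_contra hni
    exact hx1 k (Finset.mem_filter.1 hk).1 ⟨subset_closure hxk, hni⟩
  -- The measure on the patch is restricted further to the interiors; forgetting the patch
  -- afterwards only enlarges the integral, as `f ≥ 0`.
  rw [← Measure.restrict_eq_self_of_ae_mem hint]
  calc _ ≤ ∫ x in ⋃ k ∈ 𝒯.elems.filter (fun k => (cell k ∩ cell t).Nonempty),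
          interior (cell k), f x ∂(volume.restrict Ω) :=
        integral_mono_measure (Measure.restrict_mono le_rfl Measure.restrict_le_self)
          (ae_of_all _ h0) hf.integrableOn
    _ = ∑ k ∈ 𝒯.elems.filter (fun k => (cell k ∩ cell t).Nonempty),
        ∫ x in interior (cell k), f x ∂(volume.restrict Ω) :=
        integral_biUnion_finset _ (fun t _ => isOpen_interior.measurableSet)
          (fun s hs t ht hst => 𝒯.disjoint_interior_cell (Finset.mem_filter.1 hs).1
            (Finset.mem_filter.1 ht).1 hst) (fun t _ => hf.integrableOn)
    _ = _ := Finset.sum_congr rfl fun t _ =>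
        setIntegral_congr_set (interior_cell_ae_eq t Measure.absolutelyContinuous_restrict)

/-- Finite overlap of the patches of a shape regular triangulation. -/
theorem sum_setIntegral_patch_le (𝒯 : Triangulation Ω) (hd : 0 < d) {σ : ℝ}
    (hσ : 𝒯.IsShapeRegular σ) {f : Eucl d → ℝ}
    (hf : Integrable f (volume.restrict Ω)) (h0 : ∀ x, 0 ≤ f x) :
    ∑ t ∈ 𝒯.elems, ∫ x in 𝒯.patch t, f x ∂(volume.restrict Ω) ≤
      (d + 1) * |2 * σ| ^ d * ∫ x, f x ∂volume.restrict Ω := by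
  classical
  calc ∑ t ∈ 𝒯.elems, ∫ x in 𝒯.patch t, f x ∂(volume.restrict Ω)
      ≤ ∑ t ∈ 𝒯.elems, ∑ k ∈ 𝒯.elems.filter (fun k => (cell k ∩ cell t).Nonempty),
          ∫ x in cell k, f x ∂(volume.restrict Ω) :=
        Finset.sum_le_sum fun t _ => 𝒯.setIntegral_patch_le hf h0 t
    -- After exchanging the sums, each `k` is counted once for every element it meets.
    _ = ∑ k ∈ 𝒯.elems, ∑ t ∈ 𝒯.elems.filter (fun t => (cell k ∩ cell t).Nonempty),
          ∫ x in cell k, f x ∂(volume.restrict Ω) :=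
        Finset.sum_comm' fun t k => by simp only [Finset.mem_filter]; tauto
    _ ≤ ∑ k ∈ 𝒯.elems, (d + 1) * |2 * σ| ^ d * ∫ x in cell k, f x ∂(volume.restrict Ω) := by
        refine Finset.sum_le_sum fun k hk => ?_
        rw [Finset.sum_const, nsmul_eq_mul]
        exact mul_le_mul_of_nonneg_right (𝒯.card_filter_inter_nonempty_le hd hσ hk)
          (integral_nonneg h0)
    _ = _ := by rw [← Finset.mul_sum, ← 𝒯.integral_eq_sum_cell hf]

theorem ae_norm_meshSize_le (𝒯 : Triangulation Ω) :
    ∀ᵐ x ∂volume.restrict Ω, |𝒯.meshSize x| ≤ 𝒯.meshSizeSup := by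
  -- `toReal` sends `⊤` to `0`, so finiteness is needed first; the sum of all diameters is a crude
  -- bound.
  have htop : eLpNorm 𝒯.meshSize ⊤ (volume.restrict Ω) ≠ ⊤ := by
    refine ((memLp_top_of_bound (C := ∑ t ∈ 𝒯.elems, Metric.diam (cell t))
      𝒯.measurable_meshSize.aestronglyMeasurable (ae_of_all _ fun x => ?_)).eLpNorm_lt_top).ne
    refine (norm_sum_le _ _).trans (Finset.sum_le_sum fun t _ => ?_)
    refine (norm_indicator_le_norm_self _ x).trans (le_of_eq ?_)
    exact Real.norm_of_nonneg Metric.diam_nonneg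
  rw [eLpNorm_exponent_top] at htop
  filter_upwards [ae_le_eLpNormEssSup (f := 𝒯.meshSize) (μ := volume.restrict Ω)] with x hx
  rw [meshSizeSup, eLpNorm_exponent_top]
  have := (ENNReal.toReal_le_toReal (by simp) htop).2 hx
  simpa using this

theorem meshSizeSup_nonneg (𝒯 : Triangulation Ω) : 0 ≤ 𝒯.meshSizeSup := ENNReal.toReal_nonneg

theorem memLp_meshSize_mul (𝒯 : Triangulation Ω) (g : Lp ℝ 2 (volume.restrict Ω)) :
    MemLp (fun x => 𝒯.meshSize x * g x) 2 (volume.restrict Ω) := by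
  refine (Lp.memLp g).of_le_mul (c := 𝒯.meshSizeSup)
    (𝒯.measurable_meshSize.aestronglyMeasurable.mul (Lp.aestronglyMeasurable g)) ?_
  filter_upwards [𝒯.ae_norm_meshSize_le] with x hx
  rw [norm_mul]
  exact mul_le_mul_of_nonneg_right hx (norm_nonneg _)

/-- If `‖v‖_{L²(T)} ≤ c H_T ‖w‖_{L²(ω_T)}` for every element `T`, then `v = H q` with
`‖q‖_{L²(Ω)}` bounded by a multiple of `‖w‖_{L²(Ω)}`. -/
theorem exists_eq_meshSize_mul (𝒯 : Triangulation Ω) (hd : 0 < d) {σ : ℝ}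
    (hσ : 𝒯.IsShapeRegular σ) {G : Type*} [NormedAddCommGroup G]
    (v : Lp ℝ 2 (volume.restrict Ω)) (w : Lp G 2 (volume.restrict Ω)) (c : ℝ)
    (h : ∀ t ∈ 𝒯.elems, (Metric.diam (cell t))⁻¹ * l2NormOn (cell t) v ≤
      c * l2NormOn (𝒯.patch t) w) :
    ∃ q : Lp ℝ 2 (volume.restrict Ω), (∀ᵐ x ∂volume.restrict Ω, v x = 𝒯.meshSize x * q x) ∧
      ‖q‖ ≤ |c| * √((d + 1) * |2 * σ| ^ d) * ‖w‖ := by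
  have hint : ∀ᵐ x ∂volume.restrict Ω, ∃ t ∈ 𝒯.elems, x ∈ interior (cell t) := by
    filter_upwards [𝒯.ae_mem_interior_cell] with x hx
    simpa using hx
  -- The witness is `q = v / H`. The crude constant here serves only for membership in `L²`.
  have hmem : MemLp (fun x => (𝒯.meshSize x)⁻¹ * v x) 2 (volume.restrict Ω) := by
    refine (Lp.memLp v).of_le_mul (c := ∑ t ∈ 𝒯.elems, (Metric.diam (cell t))⁻¹)
      (𝒯.measurable_meshSize.inv.aestronglyMeasurable.mul (Lp.aestronglyMeasurable v)) ?_
    filter_upwards [hint] with x ⟨t, ht, hx⟩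
    rw [norm_mul, 𝒯.meshSize_eq_diam ht hx, Real.norm_of_nonneg (inv_nonneg.2 Metric.diam_nonneg)]
    refine mul_le_mul_of_nonneg_right ?_ (norm_nonneg _)
    exact Finset.single_le_sum (f := fun t => (Metric.diam (cell t))⁻¹)
      (fun t _ => inv_nonneg.2 Metric.diam_nonneg) ht
  refine ⟨hmem.toLp _, ?_, ?_⟩
  · filter_upwards [hint, hmem.coeFn_toLp] with x ⟨t, ht, hx⟩ hq
    have := 𝒯.diam_cell_pos hd ht
    rw [hq, 𝒯.meshSize_eq_diam ht hx]
    field_simp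
  -- Squares are additive over elements: the hypothesis bounds each one by `c²` times the squared
  -- norm of `w` on the patch, and finite overlap sums these. Only `c²` enters, whence `|c|`.
  · refine le_of_sq_le_sq ?_ (by positivity)
    have hw : Integrable (fun x => ‖w x‖ ^ 2) (volume.restrict Ω) := (Lp.memLp w).integrable_norm_pow (by norm_num)
    rw [Lp.norm_toLp, toReal_eLpNorm_two_sq hmem, mul_pow, mul_pow, Real.sq_sqrt (by positivity),
      sq_abs, Lp.norm_def, toReal_eLpNorm_two_sq (Lp.memLp w),
      𝒯.integral_eq_sum_cell (hmem.integrable_norm_pow (by norm_num)), mul_assoc]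
    refine le_trans ?_ (mul_le_mul_of_nonneg_left
      (𝒯.sum_setIntegral_patch_le hd hσ hw fun x => by positivity) (sq_nonneg c))
    rw [Finset.mul_sum]
    refine Finset.sum_le_sum fun t ht => ?_
    have hD := 𝒯.diam_cell_pos hd ht
    rw [← l2NormOn_sq, ← mul_pow]
    have h1 : ∫ x in cell t, ‖(𝒯.meshSize x)⁻¹ * v x‖ ^ 2 ∂(volume.restrict Ω) =
        ((Metric.diam (cell t))⁻¹ * l2NormOn (cell t) v) ^ 2 := by
      rw [mul_pow, l2NormOn_sq, ← integral_const_mul]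
      refine integral_congr_ae ?_
      have h2 : ∀ᵐ x ∂volume.restrict Ω, x ∈ cell t → x ∈ interior (cell t) :=
        (interior_cell_ae_eq t Measure.absolutelyContinuous_restrict).symm.le
      filter_upwards [ae_restrict_of_ae h2, ae_restrict_mem (measurableSet_cell t)] with x hx hxt
      rw [𝒯.meshSize_eq_diam ht (hx hxt), norm_mul, mul_pow, Real.norm_of_nonneg
        (inv_nonneg.2 hD.le)]
    rw [h1]
    exact pow_le_pow_left₀ (mul_nonneg (inv_nonneg.2 hD.le) (l2NormOn_nonneg _ _)) (h t ht) 2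

end Triangulation
-- The diffusion form: boundedness and coercivity
namespace AssumptionA1

variable {A : Eucl d → Matrix (Fin d) (Fin d) ℝ} {α β : ℝ}

/-- Cauchy-Schwarz for the form of `A x`: the quadratic `t ↦ A(ζ + tη)·(ζ + tη)` is nonnegative, so
its discriminant is not positive. Symmetry merges the cross terms, and `β` bounds the two diagonal
values. -/
theorem ae_abs_mulVec_dotProduct_le (hA : AssumptionA1 Ω A α β) :
    ∀ᵐ x ∂volume.restrict Ω, ∀ ζ η : Eucl d,
      |(A x).mulVec ζ.ofLp ⬝ᵥ η.ofLp| ≤ β * ‖ζ‖ * ‖η‖ := by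
  filter_upwards [hA.symmetric, hA.isLeast_beta.1, hA.isGreatest_alpha.1] with x hs hb ha ζ η
  have hα := hA.alpha_pos
  by_cases hζ : ζ = 0
  · simp [hζ]
  have hζ0 : 0 < ‖ζ‖ := norm_pos_iff.2 hζ
  have hβ : 0 ≤ β := by
    have h1 := (ha ζ).trans (hb ζ)
    exact hα.le.trans (le_of_mul_le_mul_right h1 (by positivity))
  have hsymm : (A x).mulVec η.ofLp ⬝ᵥ ζ.ofLp = (A x).mulVec ζ.ofLp ⬝ᵥ η.ofLp := by
    rw [dotProduct_comm, Matrix.dotProduct_mulVec, ← Matrix.mulVec_transpose, hs.eq]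
  have hquad : ∀ t : ℝ, 0 ≤ ((A x).mulVec η.ofLp ⬝ᵥ η.ofLp) * (t * t) +
      (2 * ((A x).mulVec ζ.ofLp ⬝ᵥ η.ofLp)) * t + (A x).mulVec ζ.ofLp ⬝ᵥ ζ.ofLp := by
    intro t
    have h1 : 0 ≤ (A x).mulVec (ζ + t • η).ofLp ⬝ᵥ (ζ + t • η).ofLp :=
      le_trans (by positivity) (ha (ζ + t • η))
    simp only [WithLp.ofLp_add, WithLp.ofLp_smul, Matrix.mulVec_add, Matrix.mulVec_smul,
      add_dotProduct, dotProduct_add, smul_dotProduct, dotProduct_smul, smul_eq_mul, hsymm] at h1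
    linarith
  have hdis := discrim_le_zero hquad
  rw [discrim] at hdis
  have hηη : 0 ≤ (A x).mulVec η.ofLp ⬝ᵥ η.ofLp := le_trans (by positivity) (ha η)
  have h2 : ((A x).mulVec ζ.ofLp ⬝ᵥ ζ.ofLp) * ((A x).mulVec η.ofLp ⬝ᵥ η.ofLp) ≤
      (β * ‖ζ‖ ^ 2) * (β * ‖η‖ ^ 2) :=
    mul_le_mul (hb ζ) (hb η) hηη (by positivity)
  refine abs_le_of_sq_le_sq ?_ (by positivity)
  nlinarith

theorem aestronglyMeasurable_mulVec_dotProduct (hA : AssumptionA1 Ω A α β) (v w : Pairs Ω) :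
    AEStronglyMeasurable (fun x => (A x).mulVec (v.2 x).ofLp ⬝ᵥ (w.2 x).ofLp)
      (volume.restrict Ω) := by
  have hcoord : ∀ (u : Pairs Ω) (i : Fin d),
      AEMeasurable (fun x => (u.2 x).ofLp i) (volume.restrict Ω) := fun u i =>
    (by fun_prop : Measurable fun z : Eucl d => z.ofLp i).comp_aemeasurable
      (Lp.aestronglyMeasurable u.2).aemeasurable
  simp only [dotProduct, Matrix.mulVec]
  refine AEMeasurable.aestronglyMeasurable ?_
  refine Finset.aemeasurable_fun_sum _ fun i _ => ?_
  refine (Finset.aemeasurable_fun_sum _ fun j _ => ?_).mul (hcoord w i)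
  exact (hA.measurable i j).mul (hcoord v j)

theorem integrable_mulVec_dotProduct (hA : AssumptionA1 Ω A α β) (v w : Pairs Ω) :
    Integrable (fun x => (A x).mulVec (v.2 x).ofLp ⬝ᵥ (w.2 x).ofLp) (volume.restrict Ω) := by
  have h1 : Integrable (fun x => ‖v.2 x‖ * ‖w.2 x‖) (volume.restrict Ω) :=
    (Lp.memLp v.2).norm.integrable_mul (Lp.memLp w.2).norm
  refine (h1.const_mul β).mono' (hA.aestronglyMeasurable_mulVec_dotProduct v w) ?_
  filter_upwards [hA.ae_abs_mulVec_dotProduct_le] with x hx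
  rw [← mul_assoc]
  exact hx _ _

theorem diffusionForm_add_left (hA : AssumptionA1 Ω A α β) (u v w : Pairs Ω) :
    diffusionForm A (u + v) w = diffusionForm A u w + diffusionForm A v w := by
  unfold diffusionForm
  rw [← integral_add (hA.integrable_mulVec_dotProduct u w) (hA.integrable_mulVec_dotProduct v w)]
  refine integral_congr_ae ?_
  filter_upwards [Lp.coeFn_add u.2 v.2] with x hx
  rw [Prod.snd_add, hx, Pi.add_apply, WithLp.ofLp_add, Matrix.mulVec_add, add_dotProduct]

theorem diffusionForm_add_right (hA : AssumptionA1 Ω A α β) (u v w : Pairs Ω) :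
    diffusionForm A u (v + w) = diffusionForm A u v + diffusionForm A u w := by
  unfold diffusionForm
  rw [← integral_add (hA.integrable_mulVec_dotProduct u v) (hA.integrable_mulVec_dotProduct u w)]
  refine integral_congr_ae ?_
  filter_upwards [Lp.coeFn_add v.2 w.2] with x hx
  rw [Prod.snd_add, hx, Pi.add_apply, WithLp.ofLp_add, dotProduct_add]

end AssumptionA1

theorem diffusionForm_smul_left (A : Eucl d → Matrix (Fin d) (Fin d) ℝ) (c : ℝ)
    (v w : Pairs Ω) : diffusionForm A (c • v) w = c • diffusionForm A v w := by
  unfold diffusionForm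
  rw [← integral_smul]
  refine integral_congr_ae ?_
  filter_upwards [Lp.coeFn_smul c v.2] with x hx
  rw [Prod.smul_snd, hx, Pi.smul_apply, WithLp.ofLp_smul, Matrix.mulVec_smul, smul_dotProduct]

theorem diffusionForm_smul_right (A : Eucl d → Matrix (Fin d) (Fin d) ℝ) (c : ℝ)
    (v w : Pairs Ω) : diffusionForm A v (c • w) = c • diffusionForm A v w := by
  unfold diffusionForm
  rw [← integral_smul]
  refine integral_congr_ae ?_
  filter_upwards [Lp.coeFn_smul c w.2] with x hx
  rw [Prod.smul_snd, hx, Pi.smul_apply, WithLp.ofLp_smul, dotProduct_smul]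

namespace AssumptionA1

variable {A : Eucl d → Matrix (Fin d) (Fin d) ℝ} {α β : ℝ}

/-- `⟨A∇v, ∇w⟩` as a bilinear form. -/
noncomputable def diffusionBilin (hA : AssumptionA1 Ω A α β) :
    Pairs Ω →ₗ[ℝ] Pairs Ω →ₗ[ℝ] ℝ :=
  LinearMap.mk₂ ℝ (diffusionForm A) hA.diffusionForm_add_left (diffusionForm_smul_left A)
    hA.diffusionForm_add_right (diffusionForm_smul_right A)

theorem diffusionBilin_apply (hA : AssumptionA1 Ω A α β) (v w : Pairs Ω) :
    hA.diffusionBilin v w = diffusionForm A v w := rfl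

theorem beta_pos (hA : AssumptionA1 Ω A α β) (hd : 0 < d) (hΩ : volume Ω ≠ 0) : 0 < β := by
  have : (ae (volume.restrict Ω)).NeBot := by
    rw [ae_neBot, Ne, Measure.restrict_eq_zero]; exact hΩ
  have hab : ∀ᵐ x ∂volume.restrict Ω, (∀ ζ : Eucl d, α * ‖ζ‖ ^ 2 ≤ β * ‖ζ‖ ^ 2) := by
    filter_upwards [hA.isLeast_beta.1, hA.isGreatest_alpha.1] with x hb ha ζ
    exact (ha ζ).trans (hb ζ)
  obtain ⟨x, hx⟩ := hab.exists
  let ζ : Eucl d := EuclideanSpace.single ⟨0, hd⟩ 1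
  have h1 := hx ζ
  have hζ : ‖ζ‖ = 1 := by simp [ζ]
  rw [hζ] at h1
  linarith [hA.alpha_pos]

theorem abs_diffusionForm_le (hA : AssumptionA1 Ω A α β) (hβ : 0 ≤ β) (v w : Pairs Ω) :
    |diffusionForm A v w| ≤ β * ‖v.2‖ * ‖w.2‖ := by
  have h1 : Integrable (fun x => ‖v.2 x‖ * ‖w.2 x‖) (volume.restrict Ω) :=
    (Lp.memLp v.2).norm.integrable_mul (Lp.memLp w.2).norm
  calc |diffusionForm A v w| ≤ ∫ x in Ω, β * (‖v.2 x‖ * ‖w.2 x‖) := by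
        rw [← Real.norm_eq_abs, diffusionForm]
        refine norm_integral_le_of_norm_le (h1.const_mul β) ?_
        filter_upwards [hA.ae_abs_mulVec_dotProduct_le] with x hx
        rw [← mul_assoc]
        exact hx _ _
    _ = β * ∫ x in Ω, ‖v.2 x‖ * ‖w.2 x‖ := integral_const_mul _ _
    _ ≤ β * (‖v.2‖ * ‖w.2‖) := by
        refine mul_le_mul_of_nonneg_left ?_ hβ
        refine (integral_mul_le_toReal_eLpNorm (Lp.memLp v.2).norm (Lp.memLp w.2).norm).trans ?_
        rw [eLpNorm_norm, eLpNorm_norm, Lp.norm_def, Lp.norm_def]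
    _ = _ := by ring

theorem le_diffusionForm_self (hA : AssumptionA1 Ω A α β) (v : Pairs Ω) :
    α * ‖v.2‖ ^ 2 ≤ diffusionForm A v v := by
  rw [Lp.norm_def, toReal_eLpNorm_two_sq (Lp.memLp v.2), ← integral_const_mul]
  refine integral_mono_ae (((Lp.memLp v.2).integrable_norm_pow (by norm_num)).const_mul α)
    (hA.integrable_mulVec_dotProduct v v) ?_
  filter_upwards [hA.isGreatest_alpha.1] with x hx
  exact hx _

end AssumptionA1

/-! ### The nonlinearity as a Lipschitz map into `L²` -/

namespace AssumptionA2

variable {F : Eucl d → ℝ → Eucl d → ℝ} {L₁ L₂ : ℝ}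

theorem ae_abs_sub_le (hF : AssumptionA2 Ω F L₁ L₂) :
    ∀ᵐ x ∂volume.restrict Ω, ∀ (ξ₁ ξ₂ : ℝ) (ζ₁ ζ₂ : Eucl d),
      |F x ξ₁ ζ₁ - F x ξ₂ ζ₂| ≤ L₁ * |ξ₁ - ξ₂| + L₂ * ‖ζ₁ - ζ₂‖ := by
  filter_upwards [hF.lipschitz_fst, hF.lipschitz_snd] with x h1 h2 ξ₁ ξ₂ ζ₁ ζ₂
  exact (abs_sub_le _ (F x ξ₂ ζ₁) _).trans (add_le_add (h1 _ _ _) (h2 _ _ _))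

/-- Comparison with `F x 0 0 = 0` turns the Lipschitz bounds into linear growth. -/
theorem memLp_comp (hF : AssumptionA2 Ω F L₁ L₂) (v : Pairs Ω) :
    MemLp (fun x => F x (v.1 x) (v.2 x)) 2 (volume.restrict Ω) := by
  have hm : AEStronglyMeasurable (fun x => F x (v.1 x) (v.2 x)) (volume.restrict Ω) := by
    refine AEMeasurable.aestronglyMeasurable ?_
    exact hF.measurable.comp_aemeasurable (aemeasurable_id.prodMk
      ((Lp.aestronglyMeasurable v.1).aemeasurable.prodMk
        (Lp.aestronglyMeasurable v.2).aemeasurable))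
  refine (((Lp.memLp v.1).norm.const_mul L₁).add ((Lp.memLp v.2).norm.const_mul L₂)).mono' hm ?_
  filter_upwards [hF.ae_abs_sub_le, hF.map_zero] with x hx h0
  have := hx (v.1 x) 0 (v.2 x) 0
  rw [h0, sub_zero, sub_zero, sub_zero] at this
  exact this

/-- The function `x ↦ F (x, v x, ∇v x)` as an element of `L²(Ω)`. -/
noncomputable def nemytskii (hF : AssumptionA2 Ω F L₁ L₂) (v : Pairs Ω) :
    Lp ℝ 2 (volume.restrict Ω) :=
  (hF.memLp_comp v).toLp _

theorem integral_comp_mul (hF : AssumptionA2 Ω F L₁ L₂) (v : Pairs Ω)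
    (w : Lp ℝ 2 (volume.restrict Ω)) :
    ∫ x in Ω, F x (v.1 x) (v.2 x) * w x = inner ℝ (hF.nemytskii v) w := by
  rw [L2.inner_def]
  refine integral_congr_ae ?_
  filter_upwards [(hF.memLp_comp v).coeFn_toLp] with x hx
  rw [nemytskii, hx]; simp [mul_comm]

theorem norm_nemytskii_sub_le (hF : AssumptionA2 Ω F L₁ L₂) (u v : Pairs Ω) :
    ‖hF.nemytskii u - hF.nemytskii v‖ ≤ L₁ * ‖u.1 - v.1‖ + L₂ * ‖u.2 - v.2‖ := by
  have h1 := (Lp.memLp (u.1 - v.1)).norm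
  have h2 := (Lp.memLp (u.2 - v.2)).norm
  calc ‖hF.nemytskii u - hF.nemytskii v‖ ≤ ‖L₁ • h1.toLp _ + L₂ • h2.toLp _‖ := by
        refine Lp.norm_le_norm_of_ae_le ?_
        filter_upwards [hF.ae_abs_sub_le, (hF.memLp_comp u).coeFn_toLp,
          (hF.memLp_comp v).coeFn_toLp, Lp.coeFn_sub (hF.nemytskii u) (hF.nemytskii v),
          Lp.coeFn_add (L₁ • h1.toLp _) (L₂ • h2.toLp _), Lp.coeFn_smul L₁ (h1.toLp _),
          Lp.coeFn_smul L₂ (h2.toLp _), h1.coeFn_toLp, h2.coeFn_toLp,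
          Lp.coeFn_sub u.1 v.1, Lp.coeFn_sub u.2 v.2] with x hx e1 e2 e3 e4 e5 e6 e7 e8 e9 e10
        rw [e3, e4, Pi.sub_apply, Pi.add_apply, e5, e6, Pi.smul_apply, Pi.smul_apply, e7, e8, e9,
          e10, nemytskii, nemytskii, e1, e2]
        exact (hx _ _ _ _).trans (le_abs_self _)
    _ ≤ ‖L₁ • h1.toLp _‖ + ‖L₂ • h2.toLp _‖ := norm_add_le _ _
    _ = L₁ * ‖u.1 - v.1‖ + L₂ * ‖u.2 - v.2‖ := by
        rw [norm_smul, norm_smul, Real.norm_of_nonneg hF.L₁_pos.le,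
          Real.norm_of_nonneg hF.L₂_pos.le, Lp.norm_toLp, Lp.norm_toLp, eLpNorm_norm, eLpNorm_norm,
          Lp.norm_def, Lp.norm_def]

theorem nemytskii_zero (hF : AssumptionA2 Ω F L₁ L₂) : hF.nemytskii 0 = 0 := by
  rw [nemytskii, Lp.ext_iff]
  filter_upwards [(hF.memLp_comp 0).coeFn_toLp, hF.map_zero,
    Lp.coeFn_zero ℝ 2 (volume.restrict Ω), Lp.coeFn_zero (Eucl d) 2 (volume.restrict Ω)]
    with x h1 h2 h3 h4
  rw [h1, h3, Prod.fst_zero, Prod.snd_zero, h3, h4]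
  exact h2

end AssumptionA2

/-! ### Weak gradients and finite dimension of the finite element spaces -/

theorem integral_mul_eq_inner (g w : Lp ℝ 2 (volume.restrict Ω)) :
    ∫ x in Ω, g x * w x = inner ℝ g w := by
  rw [L2.inner_def]
  exact integral_congr_ae (ae_of_all _ fun x => by simp [mul_comm])

/-- The gradient of a function in `H¹₀(Ω)` is its weak gradient. -/
theorem inner_snd_eq_neg_inner_fst {v : Pairs Ω} (hv : v ∈ H10 Ω) {ψ : Eucl d → ℝ}
    (hψ : ContDiff ℝ ∞ ψ) (hψc : HasCompactSupport ψ) (hψs : tsupport ψ ⊆ Ω) (e : Eucl d)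
    (h1 : MemLp (fun x => ψ x • e) 2 (volume.restrict Ω))
    (h2 : MemLp (fun x => fderiv ℝ ψ x e) 2 (volume.restrict Ω)) :
    inner ℝ (h1.toLp _) v.2 = -inner ℝ (h2.toLp _) v.1 := by
  -- The identity is a closed condition on pairs, so it passes from test pairs, where it is
  -- integration by parts, to their closure.
  have hclosed : IsClosed {p : Pairs Ω | inner ℝ (h1.toLp _) p.2 = -inner ℝ (h2.toLp _) p.1} :=
    isClosed_eq (by fun_prop) (by fun_prop)
  refine closure_minimal ?_ hclosed hv
  rintro p ⟨φ, hφ, hφc, -, hp1, hp2⟩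
  rw [Set.mem_ofPred_eq, L2.inner_def, L2.inner_def]
  have e1 : ∫ x in Ω, inner ℝ (h1.toLp _ x) (p.2 x) = ∫ x in Ω, ψ x * fderiv ℝ φ x e := by
    refine integral_congr_ae ?_
    filter_upwards [h1.coeFn_toLp, hp2] with x hx1 hx2
    rw [hx1, hx2, inner_smul_left, real_inner_comm, gradient, InnerProductSpace.toDual_symm_apply]
    simp
  have e2 : ∫ x in Ω, inner ℝ (h2.toLp _ x) (p.1 x) = ∫ x in Ω, fderiv ℝ ψ x e * φ x := by
    refine integral_congr_ae ?_
    filter_upwards [h2.coeFn_toLp, hp1] with x hx1 hx2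
    rw [hx1, hx2]; simp [mul_comm]
  have hs : Function.support (fun x => fderiv ℝ ψ x e) ⊆ tsupport ψ := fun x hx =>
    support_fderiv_subset ℝ (f := ψ) fun h => hx (by simp [h])
  have hψd : Continuous fun x => fderiv ℝ ψ x e :=
    (hψ.continuous_fderiv (by simp)).clm_apply continuous_const
  have hφd : Continuous fun x => fderiv ℝ φ x e :=
    (hφ.continuous_fderiv (by simp)).clm_apply continuous_const
  have hψdc : HasCompactSupport fun x => fderiv ℝ ψ x e := hψc.fderiv_apply ℝ e
  rw [e1, e2, setIntegral_eq_integral_of_forall_compl_eq_zero,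
    setIntegral_eq_integral_of_forall_compl_eq_zero]
  · exact integral_mul_fderiv_eq_neg_fderiv_mul_of_integrable
      ((hψd.mul hφ.continuous).integrable_of_hasCompactSupport hψdc.mul_right)
      ((hψ.continuous.mul hφd).integrable_of_hasCompactSupport hψc.mul_right)
      ((hψ.continuous.mul hφ.continuous).integrable_of_hasCompactSupport hψc.mul_right)
      (fun x _ => (hψ.differentiable (by simp)) x) (fun x _ => (hφ.differentiable (by simp)) x)
  · intro x hx
    rw [Function.notMem_support.1 fun h => hx (hψs (hs h)), zero_mul]
  · intro x hx
    rw [Function.notMem_support.1 fun h => hx (hψs (subset_tsupport _ h)), zero_mul]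

/-- A function in `H¹₀(Ω)` that vanishes almost everywhere has gradient zero. -/
theorem snd_eq_zero_of_fst_eq_zero (hΩ : IsOpen Ω) {v : Pairs Ω} (hv : v ∈ H10 Ω)
    (h0 : v.1 = 0) : v.2 = 0 := by
  -- Integrating by parts against `ψ e` moves the derivative off `v`, so all these pairings vanish;
  -- the fundamental lemma of the calculus of variations then applies.
  have key : ∀ e : Eucl d, ∀ᵐ x ∂(volume : Measure (Eucl d)), x ∈ Ω → inner ℝ e (v.2 x) = 0 := by
    intro e
    have hloc : LocallyIntegrableOn (fun x => inner ℝ e (v.2 x)) Ω volume := by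
      have h2 : MemLp (fun x => inner ℝ e (v.2 x)) 2 (volume.restrict Ω) :=
        (Lp.memLp v.2).const_inner e
      exact locallyIntegrableOn_of_locallyIntegrable_restrict
        (h2.locallyIntegrable (by norm_num))
    refine hΩ.ae_eq_zero_of_integral_contDiff_smul_eq_zero hloc fun ψ hψ hψc hψs => ?_
    have h1 : MemLp (fun x => ψ x • e) 2 (volume.restrict Ω) :=
      ((hψ.continuous.smul continuous_const).memLp_of_hasCompactSupport
        hψc.smul_right).restrict Ω
    have h2 : MemLp (fun x => fderiv ℝ ψ x e) 2 (volume.restrict Ω) :=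
      (((hψ.continuous_fderiv (by simp)).clm_apply
        continuous_const).memLp_of_hasCompactSupport (hψc.fderiv_apply ℝ e)).restrict Ω
    have h3 := inner_snd_eq_neg_inner_fst hv hψ hψc hψs e h1 h2
    rw [h0, inner_zero_right, neg_zero, L2.inner_def] at h3
    rw [← h3, ← setIntegral_eq_integral_of_forall_compl_eq_zero (s := Ω)]
    · refine integral_congr_ae ?_
      filter_upwards [h1.coeFn_toLp] with x hx
      rw [hx, inner_smul_left, smul_eq_mul]; simp
    · intro x hx
      rw [Function.notMem_support.1 fun h => hx (hψs (subset_tsupport _ h)), zero_smul]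
  have hall : ∀ᵐ x ∂(volume : Measure (Eucl d)), ∀ i : Fin d, x ∈ Ω →
      inner ℝ (EuclideanSpace.single i (1 : ℝ)) (v.2 x) = 0 := ae_all_iff.2 fun i => key _
  rw [Lp.ext_iff]
  filter_upwards [ae_restrict_of_ae hall, ae_restrict_mem hΩ.measurableSet,
    Lp.coeFn_zero (Eucl d) 2 (volume.restrict Ω)] with x hx hxΩ hz
  rw [hz]
  ext i
  have := hx i hxΩ
  simpa [EuclideanSpace.inner_single_left] using this

/-- The affine function `x ↦ m.1 x + m.2`, cut off outside the interior of `cell t`. -/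
noncomputable def affinePiece (t : Finset (Eucl d)) (m : (Eucl d →L[ℝ] ℝ) × ℝ) :
    Eucl d → ℝ :=
  (interior (cell t)).indicator fun x => m.1 x + m.2

theorem memLp_affinePiece (t : Finset (Eucl d)) (m : (Eucl d →L[ℝ] ℝ) × ℝ) :
    MemLp (affinePiece t m) 2 (volume.restrict Ω) := by
  have hc : Continuous fun x => m.1 x + m.2 := by fun_prop
  refine MemLp.restrict Ω ?_
  rw [affinePiece, memLp_indicator_iff_restrict isOpen_interior.measurableSet]
  obtain ⟨C, hC⟩ := (Triangulation.isCompact_cell t).exists_bound_of_continuousOn hc.continuousOn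
  have : IsFiniteMeasure ((volume : Measure (Eucl d)).restrict (interior (cell t))) :=
    ⟨by
      rw [Measure.restrict_apply_univ]
      exact (measure_mono interior_subset).trans_lt
        (Triangulation.isCompact_cell t).measure_lt_top⟩
  refine MemLp.of_bound hc.aestronglyMeasurable C ?_
  filter_upwards [ae_restrict_mem isOpen_interior.measurableSet] with x hx
  exact hC x (interior_subset hx)

/-- Piecewise affine functions as elements of `L²(Ω)`. -/
noncomputable def affinePieceLp (Ω : Set (Eucl d)) (t : Finset (Eucl d)) :
    ((Eucl d →L[ℝ] ℝ) × ℝ) →ₗ[ℝ] Lp ℝ 2 (volume.restrict Ω) where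
  toFun m := (memLp_affinePiece t m).toLp _
  map_add' m n := by
    rw [← MemLp.toLp_add]
    congr 1
    ext x
    by_cases hx : x ∈ interior (cell t) <;> simp [affinePiece, hx]; ring
  map_smul' c m := by
    rw [RingHom.id_apply, ← MemLp.toLp_const_smul]
    congr 1
    ext x
    by_cases hx : x ∈ interior (cell t) <;> simp [affinePiece, hx]; ring

namespace Triangulation

/-- Almost every point lies in exactly one open cell, so the function is the sum of its affine
pieces; each piece ranges over a finite-dimensional space. -/
theorem fst_mem_iSup_range (𝒯 : Triangulation Ω) {v : Pairs Ω} (hv : v ∈ 𝒯.feSpace) :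
    v.1 ∈ ⨆ t : 𝒯.elems, LinearMap.range (affinePieceLp Ω t.1) := by
  obtain ⟨-, f, -, hf, hfa⟩ := hv
  choose! ℓ hℓ using hfa
  let m : Finset (Eucl d) → (Eucl d →L[ℝ] ℝ) × ℝ := fun t =>
    (LinearMap.toContinuousLinearMap (ℓ t).linear, ℓ t 0)
  have hsum : v.1 = ∑ t : 𝒯.elems, affinePieceLp Ω t.1 (m t.1) := by
    rw [Lp.ext_iff]
    have h1 : ∀ᵐ x ∂volume.restrict Ω, ∀ t : 𝒯.elems,
        affinePieceLp Ω t.1 (m t.1) x = affinePiece t.1 (m t.1) x :=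
      ae_all_iff.2 fun t => (memLp_affinePiece t.1 (m t.1)).coeFn_toLp
    filter_upwards [h1, hf, 𝒯.ae_mem_interior_cell,
      Lp.coeFn_finsetSum Finset.univ fun t : 𝒯.elems => affinePieceLp Ω t.1 (m t.1)]
      with x hx1 hx2 hx3 hx4
    obtain ⟨t, ht, hxt⟩ := Set.mem_iUnion₂.1 hx3
    rw [hx4, Finset.sum_apply, Finset.sum_eq_single_of_mem (⟨t, ht⟩ : 𝒯.elems) (Finset.mem_univ _),
      hx1, hx2, hℓ t ht x (interior_subset hxt), affinePiece, Set.indicator_of_mem hxt]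
    · have := (ℓ t).map_vadd 0 x
      simpa [m] using this
    · intro s _ hst
      rw [hx1, affinePiece, Set.indicator_of_notMem]
      exact fun h => Set.disjoint_left.1 (𝒯.disjoint_interior_cell s.2 ht
        fun h' => hst (Subtype.ext h')) h hxt
  rw [hsum]
  exact Submodule.sum_mem _ fun t _ =>
    Submodule.mem_iSup_of_mem (p := fun t : 𝒯.elems => LinearMap.range (affinePieceLp Ω t.1)) t
      (LinearMap.mem_range_self _ _)

/-- Forgetting the gradient is injective on `H10 Ω` by `snd_eq_zero_of_fst_eq_zero`, and the
functions that remain lie in a finite-dimensional space. -/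
theorem finiteDimensional_feSpace (𝒯 : Triangulation Ω) (hΩ : IsOpen Ω) :
    FiniteDimensional ℝ 𝒯.feSpace := by
  let Φ : 𝒯.feSpace →ₗ[ℝ]
      (⨆ t : 𝒯.elems, LinearMap.range (affinePieceLp Ω t.1) : Submodule ℝ _) :=
    ((LinearMap.fst ℝ _ _).comp 𝒯.feSpace.subtype).codRestrict _
      fun v => 𝒯.fst_mem_iSup_range v.2
  refine FiniteDimensional.of_injective Φ ?_
  rw [← LinearMap.ker_eq_bot, LinearMap.ker_eq_bot']
  intro v hv
  have h1 : v.1.1 = 0 := congrArg Subtype.val hv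
  exact Subtype.ext (Prod.ext h1 (snd_eq_zero_of_fst_eq_zero hΩ v.2.1 h1))

end Triangulation
/-- Galerkin projection onto a finite-dimensional subspace on which a bilinear form is definite. -/
theorem exists_mem_forall_bilin_eq {E : Type*} [AddCommGroup E] [Module ℝ E]
    (b : E →ₗ[ℝ] E →ₗ[ℝ] ℝ) (V : Submodule ℝ E) [FiniteDimensional ℝ V]
    (hb : ∀ v ∈ V, b v v = 0 → v = 0) (z : E) : ∃ p ∈ V, ∀ w ∈ V, b p w = b z w := by
  -- Definiteness makes `V → V*` injective, hence surjective by dimension; `p` is the preimage of `b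
  -- z`.
  let T : V →ₗ[ℝ] Module.Dual ℝ V := b.compl₁₂ V.subtype V.subtype
  have hinj : Function.Injective T := by
    rw [← LinearMap.ker_eq_bot, LinearMap.ker_eq_bot']
    intro v hv
    exact Subtype.ext (hb v v.2 (LinearMap.congr_fun hv v))
  obtain ⟨p, hp⟩ := (LinearMap.injective_iff_surjective_of_finrank_eq_finrank
    (Subspace.dual_finrank_eq (K := ℝ) (V := V)).symm).1 hinj ((b z).comp V.subtype)
  exact ⟨p, p.2, fun w hw => LinearMap.congr_fun hp ⟨w, hw⟩⟩

/-! ### The fine scale projection and the multiscale space -/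

theorem fineSpace_le_feSpace {𝒯h 𝒯H : Triangulation Ω} (I : 𝒯h.feSpace →ₗ[ℝ] 𝒯H.feSpace) :
    fineSpace I ≤ 𝒯h.feSpace := by
  rintro _ ⟨v, -, rfl⟩
  exact v.2

/-- The form sees only gradients, so definiteness takes two steps: coercivity kills the gradient,
then the Poincaré inequality kills the function. -/
theorem exists_isFineProjection {𝒯h 𝒯H : Triangulation Ω} (hΩ : IsOpen Ω)
    {A : Eucl d → Matrix (Fin d) (Fin d) ℝ} {α β : ℝ} (hA : AssumptionA1 Ω A α β)
    {Cp : ℝ} (hCp : IsPoincareConstant Ω Cp)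
    (I : 𝒯h.feSpace →ₗ[ℝ] 𝒯H.feSpace) (z : Pairs Ω) : ∃ p, IsFineProjection A I z p := by
  have := 𝒯h.finiteDimensional_feSpace hΩ
  have : FiniteDimensional ℝ (fineSpace I) := by unfold fineSpace; infer_instance
  obtain ⟨p, hp, h⟩ := exists_mem_forall_bilin_eq hA.diffusionBilin (fineSpace I) (by
    intro v hv h0
    have h1 := hA.le_diffusionForm_self v
    rw [← hA.diffusionBilin_apply, h0] at h1
    have h2 : ‖v.2‖ = 0 := by
      have := hA.alpha_pos
      have h3 : ‖v.2‖ ^ 2 ≤ 0 := by nlinarith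
      exact pow_eq_zero_iff (two_ne_zero) |>.1 (le_antisymm h3 (sq_nonneg _))
    have h3 := hCp.2 v (fineSpace_le_feSpace I hv).1
    rw [h2, mul_zero] at h3
    exact Prod.ext (norm_le_zero_iff.1 h3) (norm_eq_zero.1 h2)) z
  exact ⟨p, hp, h⟩

theorem multiscaleSpace_subset_feSpace {𝒯h 𝒯H : Triangulation Ω} (href : 𝒯h.IsRefinementOf 𝒯H)
    (A : Eucl d → Matrix (Fin d) (Fin d) ℝ) (I : 𝒯h.feSpace →ₗ[ℝ] 𝒯H.feSpace) :
    multiscaleSpace A I ⊆ 𝒯h.feSpace := by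
  rintro _ ⟨v, hv, p, hp, rfl⟩
  exact 𝒯h.feSpace.sub_mem (Triangulation.feSpace_le_of_isRefinementOf href hv)
    (fineSpace_le_feSpace I hp.1)

namespace AssumptionA1

variable {A : Eucl d → Matrix (Fin d) (Fin d) ℝ} {α β : ℝ}

theorem diffusionForm_sub_left (hA : AssumptionA1 Ω A α β) (u v w : Pairs Ω) :
    diffusionForm A (u - v) w = diffusionForm A u w - diffusionForm A v w := by
  simp only [← hA.diffusionBilin_apply, map_sub, LinearMap.sub_apply]

theorem sub_mem_multiscaleSpace (hA : AssumptionA1 Ω A α β) {𝒯h 𝒯H : Triangulation Ω}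
    (I : 𝒯h.feSpace →ₗ[ℝ] 𝒯H.feSpace) {v w : Pairs Ω} (hv : v ∈ multiscaleSpace A I)
    (hw : w ∈ multiscaleSpace A I) : v - w ∈ multiscaleSpace A I := by
  obtain ⟨v', hv', p, hp, rfl⟩ := hv
  obtain ⟨w', hw', q, hq, rfl⟩ := hw
  refine ⟨v' - w', 𝒯H.feSpace.sub_mem hv' hw', p - q,
    ⟨(fineSpace I).sub_mem hp.1 hq.1, fun z hz => ?_⟩, by abel⟩
  rw [hA.diffusionForm_sub_left, hA.diffusionForm_sub_left, hp.2 z hz, hq.2 z hz]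

/-- Choose `v_H` with `I v_H = I v`. Then `f = v - v_H` is a fine function, fixed by `P`, so `P(v_H)
= p - f` and `v - p = v_H - P(v_H)`. -/
theorem sub_projection_mem_multiscaleSpace (hA : AssumptionA1 Ω A α β) {𝒯h 𝒯H : Triangulation Ω}
    {href : 𝒯h.IsRefinementOf 𝒯H} {I : 𝒯h.feSpace →ₗ[ℝ] 𝒯H.feSpace} {CI CI' : ℝ}
    (hI : AssumptionsA4A7 href I CI CI') {v p : Pairs Ω} (hv : v ∈ 𝒯h.feSpace)
    (hp : IsFineProjection A I v p) : v - p ∈ multiscaleSpace A I := by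
  obtain ⟨vH, hvH⟩ := hI.bijective_restriction.2 (I ⟨v, hv⟩)
  have hf : v - vH.1 ∈ fineSpace I := by
    refine ⟨⟨v, hv⟩ - Submodule.inclusion (Triangulation.feSpace_le_of_isRefinementOf href) vH,
      ?_, rfl⟩
    rw [SetLike.mem_coe, LinearMap.mem_ker, map_sub, sub_eq_zero]
    exact hvH.symm
  refine ⟨vH, vH.2, p - (v - vH.1), ⟨(fineSpace I).sub_mem hp.1 hf, fun w hw => ?_⟩, by abel⟩
  rw [hA.diffusionForm_sub_left, hA.diffusionForm_sub_left, hp.2 w hw]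
  ring

end AssumptionA1

/-- A fine scale function is `H` times an `L²` function bounded by its gradient. -/
theorem AssumptionsA4A7.exists_eq_meshSize_mul (hd : 0 < d) {𝒯h 𝒯H : Triangulation Ω}
    {href : 𝒯h.IsRefinementOf 𝒯H} {σ : ℝ} (hσ : 𝒯H.IsShapeRegular σ)
    {I : 𝒯h.feSpace →ₗ[ℝ] 𝒯H.feSpace} {CI CI' : ℝ} (hI : AssumptionsA4A7 href I CI CI')
    {p : Pairs Ω} (hp : p ∈ fineSpace I) :
    ∃ q : Lp ℝ 2 (volume.restrict Ω), (∀ᵐ x ∂volume.restrict Ω, p.1 x = 𝒯H.meshSize x * q x) ∧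
      ‖q‖ ≤ |CI| * √((d + 1) * |2 * σ| ^ d) * ‖p.2‖ := by
  obtain ⟨v, hv, rfl⟩ := hp
  rw [SetLike.mem_coe, LinearMap.mem_ker] at hv
  refine 𝒯H.exists_eq_meshSize_mul hd hσ _ _ CI fun t ht => ?_
  have h := hI.local_estimate v t ht
  -- On the kernel of `I` the interpolation error is the function itself.
  have h0 : (v.1.1 - (I v).1.1) = v.1.1 := by
    rw [hv]; exact sub_zero _
  rw [h0] at h
  exact (le_add_of_nonneg_right (l2NormOn_nonneg _ _)).trans h

namespace Triangulation

theorem norm_le_meshSizeSup_mul (𝒯 : Triangulation Ω) {v q : Lp ℝ 2 (volume.restrict Ω)}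
    (h : ∀ᵐ x ∂volume.restrict Ω, v x = 𝒯.meshSize x * q x) :
    ‖v‖ ≤ 𝒯.meshSizeSup * ‖q‖ := by
  refine Lp.norm_le_mul_norm_of_ae_le_mul ?_
  filter_upwards [h, 𝒯.ae_norm_meshSize_le] with x h1 h2
  rw [h1, norm_mul]
  exact mul_le_mul_of_nonneg_right h2 (norm_nonneg _)

/-- The weight `H` moves from `v` to `g`; this yields `‖Hg‖` instead of the larger `‖H‖_∞‖g‖`. -/
theorem inner_le_meshWeightedNorm_mul (𝒯 : Triangulation Ω) (g : Lp ℝ 2 (volume.restrict Ω))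
    {v q : Lp ℝ 2 (volume.restrict Ω)}
    (h : ∀ᵐ x ∂volume.restrict Ω, v x = 𝒯.meshSize x * q x) :
    inner ℝ g v ≤ 𝒯.meshWeightedNorm g * ‖q‖ := by
  rw [← integral_mul_eq_inner]
  refine le_trans (le_of_eq (integral_congr_ae ?_))
    (integral_mul_le_toReal_eLpNorm (𝒯.memLp_meshSize_mul g) (Lp.memLp q))
  filter_upwards [h] with x hx
  rw [hx]; ring

end Triangulation

/-! ### The nonlinear operator and the error estimate -/

theorem operatorB_eq (A : Eucl d → Matrix (Fin d) (Fin d) ℝ) {F : Eucl d → ℝ → Eucl d → ℝ}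
    {L₁ L₂ : ℝ} (hF : AssumptionA2 Ω F L₁ L₂) (v w : Pairs Ω) :
    operatorB A F v w = diffusionForm A v w + inner ℝ (hF.nemytskii v) w.1 := by
  rw [operatorB, hF.integral_comp_mul]

/-- A priori bound for Galerkin solutions. -/
theorem norm_snd_le_of_isGalerkinSolution {A : Eucl d → Matrix (Fin d) (Fin d) ℝ} {α β : ℝ}
    (hA : AssumptionA1 Ω A α β) {F : Eucl d → ℝ → Eucl d → ℝ} {L₁ L₂ : ℝ}
    (hF : AssumptionA2 Ω F L₁ L₂) {c₀ : ℝ} (hB : AssumptionA3 Ω A F c₀) {Cp : ℝ}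
    (hCp : IsPoincareConstant Ω Cp) {g : Lp ℝ 2 (volume.restrict Ω)} {W : Set (Pairs Ω)}
    {u : Pairs Ω} (hu : IsGalerkinSolution A F g W u) (huH : u ∈ H10 Ω) :
    c₀ * ‖u.2‖ ≤ Cp * ‖g‖ := by
  -- Monotonicity is used against `0`, where `B` vanishes; the equation is then tested with `u`
  -- itself.
  have h1 := hB.strongly_monotone u huH 0 (H10 Ω).zero_mem
  have h0 : operatorB A F 0 u = 0 := by
    rw [operatorB_eq A hF, hF.nemytskii_zero, inner_zero_left, ← hA.diffusionBilin_apply]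
    simp
  rw [sub_zero, Prod.snd_zero, sub_zero, h0, sub_zero, hu.2 u hu.1, integral_mul_eq_inner] at h1
  have h2 := (real_inner_le_norm g u.1).trans
    (mul_le_mul_of_nonneg_left (hCp.2 u huH) (norm_nonneg g))
  rcases (norm_nonneg u.2).eq_or_lt with h | h
  · rw [← h, mul_zero]
    exact mul_nonneg hCp.1 (norm_nonneg g)
  · refine le_of_mul_le_mul_right ?_ h
    linarith

end LOD

theorem mainTheorem3 (d : ℕ) (hd : 0 < d) (σ CI CI' : ℝ) :
    ∃ C : ℝ, 0 < C ∧
      ∀ (Ω : Set (LOD.Eucl d)) (_ : LOD.IsLipschitzDomain Ω) (_ : Bornology.IsBounded Ω)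
        (𝒯H 𝒯h : LOD.Triangulation Ω) (href : 𝒯h.IsRefinementOf 𝒯H)
        (_ : 𝒯H.IsShapeRegular σ) (_ : 𝒯h.IsShapeRegular σ)
        (Cp : ℝ) (_ : LOD.IsPoincareConstant Ω Cp)
        (A : LOD.Eucl d → Matrix (Fin d) (Fin d) ℝ) (α β : ℝ) (_ : LOD.AssumptionA1 Ω A α β)
        (F : LOD.Eucl d → ℝ → LOD.Eucl d → ℝ) (L₁ L₂ : ℝ) (_ : LOD.AssumptionA2 Ω F L₁ L₂)
        (c₀ : ℝ) (_ : LOD.AssumptionA3 Ω A F c₀)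
        (I : 𝒯h.feSpace →ₗ[ℝ] 𝒯H.feSpace) (_ : LOD.AssumptionsA4A7 href I CI CI')
        (g : MeasureTheory.Lp ℝ 2 (MeasureTheory.volume.restrict Ω))
        (uh ums : LOD.Pairs Ω)
        (_ : LOD.IsGalerkinSolution A F g 𝒯h.feSpace uh)
        (_ : LOD.IsGalerkinSolution A F g (LOD.multiscaleSpace A I) ums),
        ‖uh.2 - ums.2‖ ≤
          C * ((β + 𝒯H.meshSizeSup * (L₁ * Cp + L₂)) / (c₀ * α)) *
            (𝒯H.meshWeightedNorm g +
              𝒯H.meshSizeSup * Cp * ((L₁ * Cp + L₂) / c₀) * ‖g‖) := by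
  -- The square root comes from patch overlap. The summand `1` gives `κ ≥ 1`, which lets the `β`
  -- term absorb a factor `κ`. The bounds `hfine` and `herr` contribute one `κ` each to the constant
  -- `κ ^ 2`.
  set κ : ℝ := 1 + |CI| * √((d + 1) * |2 * σ| ^ d) with hκ
  have hκ1 : 1 ≤ κ := le_add_of_nonneg_right (by positivity)
  refine ⟨κ ^ 2, by positivity, ?_⟩
  intro Ω hΩ _ 𝒯H 𝒯h href hσ _ Cp hCp A α β hA F L₁ L₂ hF c₀ hB I hI g uh ums huh hums
  have hα := hA.alpha_pos
  have hc₀ := hB.c₀_pos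
  have hL₁ := hF.L₁_pos
  have hL₂ := hF.L₂_pos
  have hCp0 := hCp.1
  have hβ : 0 < β := hA.beta_pos hd (hΩ.isOpen.measure_pos _ hΩ.isConnected.nonempty).ne'
  obtain ⟨p, hp⟩ := LOD.exists_isFineProjection hΩ.isOpen hA hCp I uh
  obtain ⟨q, hpq, hq⟩ := hI.exists_eq_meshSize_mul hd hσ hp.1
  replace hq : ‖q‖ ≤ κ * ‖p.2‖ :=
    hq.trans (mul_le_mul_of_nonneg_right (by rw [hκ]; linarith) (norm_nonneg _))
  have hmem : ∀ w ∈ 𝒯h.feSpace, w ∈ LOD.H10 Ω := fun w hw => hw.1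
  have humsh := LOD.multiscaleSpace_subset_feSpace href A I hums.1
  have hph := LOD.fineSpace_le_feSpace I hp.1
  set S := 𝒯H.meshSizeSup with hS
  have hS0 : 0 ≤ S := 𝒯H.meshSizeSup_nonneg
  set M := L₁ * Cp + L₂ with hM
  have hM0 : 0 < M := by positivity
  -- By the Poincaré inequality the nonlinearity is `M`-Lipschitz in the gradient seminorm on `V_h`.
  have hN : ∀ u ∈ 𝒯h.feSpace, ∀ v ∈ 𝒯h.feSpace,
      ‖hF.nemytskii u - hF.nemytskii v‖ ≤ M * ‖u.2 - v.2‖ := by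
    intro u hu v hv
    have h1 := hF.norm_nemytskii_sub_le u v
    have h2 := hCp.2 (u - v) (hmem _ (𝒯h.feSpace.sub_mem hu hv))
    rw [Prod.fst_sub, Prod.snd_sub] at h2
    have h3 := mul_le_mul_of_nonneg_left h2 hL₁.le
    rw [hM]
    linarith
  have hp1 : ‖p.1‖ ≤ S * (κ * ‖p.2‖) :=
    (𝒯H.norm_le_meshSizeSup_mul hpq).trans (mul_le_mul_of_nonneg_left hq hS0)
  have hu := LOD.norm_snd_le_of_isGalerkinSolution hA hF hB hCp huh (hmem _ huh.1)
  set R := 𝒯H.meshWeightedNorm g + S * Cp * (M / c₀) * ‖g‖ with hR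
  have hW0 : 0 ≤ 𝒯H.meshWeightedNorm g := ENNReal.toReal_nonneg
  have hR0 : 0 ≤ R := by positivity
  have hfine : α * ‖p.2‖ ≤ κ * R := by
    -- The projection replaces `p` by `u_h` in the first slot; then the Galerkin equation is tested
    -- with `p`.
    have h1 : LOD.diffusionForm A p p = inner ℝ g p.1 - inner ℝ (hF.nemytskii uh) p.1 := by
      have h := huh.2 p hph
      rw [LOD.operatorB_eq A hF, LOD.integral_mul_eq_inner] at h
      rw [hp.2 p hp.1]
      linarith
    have h2 := 𝒯H.inner_le_meshWeightedNorm_mul g hpq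
    have h3 : ‖hF.nemytskii uh‖ ≤ M * (Cp * ‖g‖ / c₀) := by
      have h := hN uh huh.1 0 𝒯h.feSpace.zero_mem
      rw [hF.nemytskii_zero, sub_zero, Prod.snd_zero, sub_zero] at h
      refine h.trans (mul_le_mul_of_nonneg_left ?_ hM0.le)
      rw [le_div_iff₀ hc₀]
      linarith
    have h4 : -inner ℝ (hF.nemytskii uh) p.1 ≤ M * (Cp * ‖g‖ / c₀) * (S * (κ * ‖p.2‖)) :=
      (neg_le_abs _).trans ((abs_real_inner_le_norm _ _).trans
        (mul_le_mul h3 hp1 (norm_nonneg _) (by positivity)))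
    have h5 : 𝒯H.meshWeightedNorm g * ‖q‖ ≤ 𝒯H.meshWeightedNorm g * (κ * ‖p.2‖) :=
      mul_le_mul_of_nonneg_left hq hW0
    have h6 := hA.le_diffusionForm_self p
    have h7 : α * ‖p.2‖ ^ 2 ≤ κ * R * ‖p.2‖ := by
      have : κ * R * ‖p.2‖ = 𝒯H.meshWeightedNorm g * (κ * ‖p.2‖) +
          M * (Cp * ‖g‖ / c₀) * (S * (κ * ‖p.2‖)) := by
        rw [hR]; ring
      linarith
    rcases (norm_nonneg p.2).eq_or_lt with h | h
    · rw [← h, mul_zero]; positivity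
    · refine le_of_mul_le_mul_right ?_ h
      linarith
  have herr : c₀ * ‖uh.2 - ums.2‖ ≤ κ * (β + S * M) * ‖p.2‖ := by
    have h1 := hB.strongly_monotone uh (hmem _ huh.1) ums (hmem _ humsh)
    have hw := hA.sub_mem_multiscaleSpace I
      (hA.sub_projection_mem_multiscaleSpace hI huh.1 hp) hums.1
    have hsplit : ∀ v : LOD.Pairs Ω, LOD.operatorB A F v (uh - ums) =
        LOD.operatorB A F v p + LOD.operatorB A F v (uh - p - ums) := by
      intro v
      have h : uh - ums = p + (uh - p - ums) := by abel
      rw [LOD.operatorB_eq A hF, LOD.operatorB_eq A hF, LOD.operatorB_eq A hF, h,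
        hA.diffusionForm_add_right, Prod.fst_add, inner_add_right]
      ring
    -- Galerkin orthogonality: on `uh - p - ums` both operators equal the pairing with `g` and
    -- cancel, leaving only the test function `p`.
    rw [hsplit, hsplit, hums.2 _ hw, huh.2 _ (LOD.multiscaleSpace_subset_feSpace href A I hw),
      add_sub_add_right_eq_sub, LOD.operatorB_eq A hF, LOD.operatorB_eq A hF,
      add_sub_add_comm, ← hA.diffusionForm_sub_left, ← inner_sub_left] at h1
    have h2 := (le_abs_self _).trans (hA.abs_diffusionForm_le hβ.le (uh - ums) p)
    rw [Prod.snd_sub] at h2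
    have h3 := (real_inner_le_norm (hF.nemytskii uh - hF.nemytskii ums) p.1).trans
      (mul_le_mul (hN uh huh.1 ums humsh) hp1 (norm_nonneg _) (by positivity))
    have h4 : β * ‖uh.2 - ums.2‖ * ‖p.2‖ ≤ κ * (β * ‖uh.2 - ums.2‖ * ‖p.2‖) :=
      le_mul_of_one_le_left (by positivity) hκ1
    have h5 : c₀ * ‖uh.2 - ums.2‖ ^ 2 ≤ κ * (β + S * M) * ‖p.2‖ * ‖uh.2 - ums.2‖ := by
      linarith
    rcases (norm_nonneg (uh.2 - ums.2)).eq_or_lt with h | h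
    · rw [← h, mul_zero]; positivity
    · refine le_of_mul_le_mul_right ?_ h
      linarith
  have hfinal : c₀ * α * ‖uh.2 - ums.2‖ ≤ κ * (β + S * M) * (κ * R) :=
    calc c₀ * α * ‖uh.2 - ums.2‖ = α * (c₀ * ‖uh.2 - ums.2‖) := by ring
      _ ≤ α * (κ * (β + S * M) * ‖p.2‖) := mul_le_mul_of_nonneg_left herr hα.le
      _ = κ * (β + S * M) * (α * ‖p.2‖) := by ring
      _ ≤ κ * (β + S * M) * (κ * R) := mul_le_mul_of_nonneg_left hfine (by positivity)
  calc ‖uh.2 - ums.2‖ ≤ κ * (β + S * M) * (κ * R) / (c₀ * α) := by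
        rw [le_div_iff₀ (by positivity)]; linarith
    _ = κ ^ 2 * ((β + S * M) / (c₀ * α)) * R := by ring
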